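/- **Setting.** A *web* is a finite bipartite graph $D$ (vertices colored black and white, edges joining vertices of different colors), embedded without crossings in an oriented disk, whose vertices are boundary vertices on the boundary circle, numbered $1,\dots,n$ clockwise, and internal vertices, each of degree 3. Webs are considered up to isotopy fixing the boundary. We assume that all boundary vertices have degree 1. $D$ is *non-elliptic* if it has no multiple edges and no 4-cycle all of whose vertices are internal. The *sign string* $S=(s_1,\dots,s_n)$ of $D$ has $s_i=+$ if the boundary vertex $i$ is black and $s_i=-$ if it is white. A *proper edge coloring* of $D$ assigns to each edge a color in $\{-1,0,1\}$ so that the edges at every internal vertex have distinct colors. Proper edge colorings are compared lexicographically through the words of colors of the boundary edges $1,\dots,n$, using $1<0<-1$ at black boundary vertices and $-1<0<1$ at white ones. The invariant of $D$ is $$[D]=\sum_{\ell}\ \prod_{v\ \mathrm{internal}}\operatorname{sign}(\ell(v))\ \prod_{i\ \mathrm{black}}x_{\ell(i),i}\ \prod_{i\ \mathrm{white}}y_{i,\ell(i)},$$ the sum over all proper edge colorings $\ell$, where $\ell(i)$ is the color of the edge at the boundary vertex $i$ and $\operatorname{sign}(\ell(v))$ is $+1$ if the colors at $v$, read clockwise,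 are cyclically $-1,0,1$, and $-1$ otherwise. Order the variables first by the number $i$ of the boundary vertex, and then by $x_{-1,i}<x_{0,i}<x_{1,i}$ if $i$ is black and $y_{i,1}<y_{i,0}<y_{i,-1}$ if $i$ is white. In the graded reverse lexicographic order a monomial is larger if its total degree is larger or, the degrees being equal, if it has the smaller exponent at the smallest variable at which the exponents differ. *Growth algorithm.* Let $w_1,w_0,w_{-1}$ be the weights of the standard representation of $\mathrm{SL}_3$, so that $w_1+w_0+w_{-1}=0$; the pair $(+,j)$ has weight $w_j$ and $(-,j)$ has weight $-w_{-j}$. For a state string $J\in\{-1,0,1\}^n$, the sign and state string $(S,J)$ is *dominant* if all partial sums of the weights of its entries $(s_k,j_k)$ are non-negative integral combinations of the weights of $(+,1)$ and $(-,1)$, and the total sum is $0$. Start from a horizontal line carrying the boundary vertices from left to right, with a strand of sign $s_k$ and state $j_k$ hanging from vertex $k$, and repeatedly apply one of the following rules to two neighboring strands, until no strand is left: * different signs, states $(1,-1)$: join the two strands to each other; * different signs, states $(1,0)$, $(0,0)$ or $(0,-1)$: let the two strands end at two new vertices joined by a horizontal edge, with new strands hanging from them that have states $(0,1)$, $(-1,1)$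 or $(-1,0)$ respectively, and interchanged signs; * equal signs, states $(1,0)$, $(0,-1)$ or $(1,-1)$: let the two strands end at one new vertex, with a new strand of opposite sign and of state $1$, $-1$ or $0$ respectively hanging from it. Finally close the line up to the boundary of a disk. A *KK-labeling* of $D$ is a state string $J$ such that $(S,J)$ is dominant and the growth algorithm produces $D$ from it. It determines an edge coloring of $D$: an edge carrying a strand of sign $+$ and state $j$ gets the color $j$, one carrying a strand of sign $-$ and state $j$ gets the color $-j$, and each horizontal edge gets the color that makes the coloring proper. **Theorem.** Let $D$ be a non-elliptic web all of whose boundary vertices have degree 1. Then $D$ has exactly one KK-labeling, and this labeling determines exactly one proper edge coloring $\ell$ of $D$. The coloring $\ell$ is the lexicographic minimum: every other proper edge coloring of $D$ is strictly larger than $\ell$. Moreover, the monomial of $\ell$ is the leading monomial of $[D]$ in the graded reverse lexicographic order above, and its coefficient in $[D]$ is $\prod_v\operatorname{sign}(\ell(v))=\pm1$. -/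

import Mathlib

open scoped BigOperators

/-- The half-edges of a tensor diagram with boundary vertices `0, ..., n - 1`, each of degree one,
and set `V` of internal (trivalent) vertices: `Sum.inl i` is the half-edge at the boundary vertex
`i`, and `Sum.inr (v, 0)`, `Sum.inr (v, 1)`, `Sum.inr (v, 2)` are the three half-edges at the
internal vertex `v`, listed in clockwise order. -/
abbrev HalfEdge (n : ℕ) (V : Type*) := Fin n ⊕ V × Fin 3

/-- The vertex at which a half-edge is based. -/
def HalfEdge.base {n : ℕ} {V : Type*} (d : HalfEdge n V) : Fin n ⊕ V := Sum.map id Prod.fst d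

/-- A tensor diagram (bipartite, internal vertices trivalent with a fixed cyclic order of the
incident edges) all of whose boundary vertices have degree one, the boundary vertices being numbered
clockwise.  An edge is a pair `{d, mate d}` of half-edges; multiple edges are possible.
The embedding in the disk is expressed by `SL3Web.IsPlanar`. -/
structure SL3Web (n : ℕ) (V : Type*) where
  /-- The vertex coloring: `true` is black, `false` is white. -/
  black : Fin n ⊕ V → Bool
  /-- The other half of an edge. -/
  mate : HalfEdge n V → HalfEdge n V
  mate_mate : ∀ d, mate (mate d) = d
  /-- The two ends of an edge have different colors (in particular `mate d ≠ d`). -/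
  black_mate : ∀ d, black (mate d).base = !black d.base

namespace SL3Web

variable {n : ℕ} {V : Type*}

/-! ### Planarity and non-ellipticity -/

/-- `mate` as a permutation of the half-edges. -/
def matePerm (D : SL3Web n V) : Equiv.Perm (HalfEdge n V) where
  toFun := D.mate
  invFun := D.mate
  left_inv := D.mate_mate
  right_inv := D.mate_mate

/-- The rotation system on the sphere obtained by collapsing the boundary circle of the disk, with
everything outside, to one additional vertex: the next half-edge in clockwise order around the same
vertex.  Clockwise around the additional vertex is counterclockwise along the boundary circle. -/
def rotation (n : ℕ) (V : Type*) : Equiv.Perm (HalfEdge n V) :=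
  Equiv.sumCongr (finRotate n).symm (Equiv.prodCongr (Equiv.refl V) (finRotate 3))

/-- The number of cycles of a permutation, fixed points included. -/
noncomputable def cycleCount {α : Type*} (f : Equiv.Perm α) : ℕ :=
  Nat.card (Quotient (Equiv.Perm.SameCycle.setoid f))

/-- The number of connected components of the graph on the sphere. -/
noncomputable def componentCount (D : SL3Web n V) : ℕ :=
  Nat.card (Quot fun d e : HalfEdge n V => e = rotation n V d ∨ e = D.mate d)

/-- `D` is embedded in the disk, with the given clockwise order of the boundary vertices and of the
edges at each internal vertex: the rotation system on the sphere has genus zero, that is, Euler's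
formula `#vertices + #faces = #edges + 2 * #components` holds, where the faces are the cycles of
`rotation * mate`. -/
def IsPlanar (D : SL3Web n V) : Prop :=
  cycleCount (rotation n V) + cycleCount (rotation n V * D.matePerm) =
    cycleCount D.matePerm + 2 * D.componentCount

/-- Two vertices are joined by an edge. -/
def Adj (D : SL3Web n V) (u w : Fin n ⊕ V) : Prop :=
  ∃ d : HalfEdge n V, d.base = u ∧ (D.mate d).base = w

/-- No multiple edges, and no 4-cycle whose vertices are all internal.  (Adjacent vertices of a
4-cycle are automatically distinct, as `D` is bipartite.) -/
def IsNonElliptic (D : SL3Web n V) : Prop :=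
  (∀ d e : HalfEdge n V, d.base = e.base → (D.mate d).base = (D.mate e).base → d = e) ∧
  ∀ p q r s : V, p ≠ r → q ≠ s →
    ¬ (D.Adj (.inr p) (.inr q) ∧ D.Adj (.inr q) (.inr r) ∧
       D.Adj (.inr r) (.inr s) ∧ D.Adj (.inr s) (.inr p))

/-! ### Proper edge colorings and the lexicographic order -/

/-- `c` is a proper edge coloring with colors `-1, 0, 1`: both halves of an edge have the same
color, and the edges at an internal vertex have distinct colors. -/
def IsProper (D : SL3Web n V) (c : HalfEdge n V → SignType) : Prop :=
  (∀ d, c (D.mate d) = c d) ∧ ∀ v : V, Function.Injective fun k : Fin 3 => c (.inr (v, k))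

/-- The order of colors at boundary vertex `i`: `1 < 0 < -1` if `i` is black and `-1 < 0 < 1` if
`i` is white. -/
def ColorLT (D : SL3Web n V) (i : Fin n) (a b : SignType) : Prop :=
  if D.black (.inl i) then b < a else a < b

/-- `c` is strictly smaller than `c'` in the lexicographic order of the words read along the
boundary. -/
def LexLT (D : SL3Web n V) (c c' : HalfEdge n V → SignType) : Prop :=
  Pi.Lex (· < ·) (fun {i} => D.ColorLT i) (fun i : Fin n => c (.inl i)) (fun i => c' (.inl i))

/-! ### Sign and state strings; the growth algorithm -/

/-- The weight of a sign (`true` is `+`) and a state, in the coordinates of the weight lattice in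
which the weights of `(+, 1)` and `(-, 1)` are the basis.  The weights of `(+, 1)`, `(+, 0)`,
`(+, -1)` sum to zero, and the weight of `(-, -j)` is the negative of that of `(+, j)`. -/
def weight : Bool → SignType → ℤ × ℤ
  | true, .pos => (1, 0)
  | true, .zero => (-1, 1)
  | true, .neg => (0, -1)
  | false, .pos => (0, 1)
  | false, .zero => (1, -1)
  | false, .neg => (-1, 0)

/-- The lattice path of the sign and state string `(S, J)` stays in the dominant chamber and ends at
the origin. -/
def IsDominant (S : Fin n → Bool) (J : Fin n → SignType) : Prop :=
  (∀ k : ℕ, 0 ≤ ∑ i with i.val < k, weight (S i) (J i)) ∧ ∑ i, weight (S i) (J i) = 0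

/-- States in the growth rules that draw an H (signs of the two strands different):
top left, top right, bottom left, bottom right. -/
inductive RuleH : SignType → SignType → SignType → SignType → Prop
  | one_zero : RuleH 1 0 0 1
  | zero_zero : RuleH 0 0 (-1) 1
  | zero_neg : RuleH 0 (-1) (-1) 0

/-- States in the growth rules that draw a Y (signs of the two strands equal):
top left, top right, bottom. -/
inductive RuleY : SignType → SignType → SignType → Prop
  | one_zero : RuleY 1 0 1
  | zero_neg : RuleY 0 (-1) (-1)
  | one_neg : RuleY 1 (-1) 0

/-- A stage of the growth algorithm drawing the web `D`: the dangling strands from left to right,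
each recorded as the upper half-edge of its edge in `D` together with its state, and the set of
internal vertices drawn so far.  The sign of a strand is `+` if the vertex that it hangs from is
black, and `-` if that vertex is white. -/
structure Stage (n : ℕ) (V : Type*) where
  strands : List (HalfEdge n V × SignType)
  drawn : Finset V

/-- One application of a growth rule to two neighboring strands, drawing a new piece of `D`, the
boundary line being at the top and the web below it.
As `D` is bipartite, the two strands have different signs in `capU` and `stepH`, which swaps them,
and equal signs in `stepY`, where the new strand gets the opposite sign. -/
inductive GrowthStep [DecidableEq V] (D : SL3Web n V) : Stage n V → Stage n V → Prop
  /-- Strands with states `1, -1` and different signs are joined to each other. -/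
  | capU (L R : List (HalfEdge n V × SignType)) (U : Finset V) (d e : HalfEdge n V)
      (hde : D.mate d = e) :
      GrowthStep D ⟨L ++ (d, 1) :: (e, -1) :: R, U⟩ ⟨L ++ R, U⟩
  /-- Strands `d`, `e` end at a new vertex `v`, from which the new strand hangs. Clockwise around
  `v`: `d`, `e`, new strand. -/
  | stepY (L R : List (HalfEdge n V × SignType)) (U : Finset V) (d e : HalfEdge n V)
      (v : V) (k : Fin 3) (a b s : SignType) (hs : RuleY a b s) (hv : v ∉ U)
      (hd : D.mate d = .inr (v, k)) (he : D.mate e = .inr (v, k + 1)) :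
      GrowthStep D ⟨L ++ (d, a) :: (e, b) :: R, U⟩
        ⟨L ++ (.inr (v, k + 2), s) :: R, insert v U⟩
  /-- Strand `d` ends at a new vertex `v` and strand `e` at a new vertex `w`, these two vertices are
  joined by a horizontal edge, and a new strand hangs from each of them. Clockwise around `v`:
  `d`, horizontal edge, new strand; clockwise around `w`: `e`, new strand, horizontal edge. -/
  | stepH (L R : List (HalfEdge n V × SignType)) (U : Finset V) (d e : HalfEdge n V)
      (v w : V) (k l : Fin 3) (a b s t : SignType) (hs : RuleH a b s t) (hv : v ∉ U) (hw : w ∉ U)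
      (hd : D.mate d = .inr (v, k)) (he : D.mate e = .inr (w, l))
      (hvw : D.mate (.inr (v, k + 1)) = .inr (w, l + 2)) :
      GrowthStep D ⟨L ++ (d, a) :: (e, b) :: R, U⟩
        ⟨L ++ (.inr (v, k + 2), s) :: (.inr (w, l + 1), t) :: R, insert v (insert w U)⟩

/-- The start of the growth algorithm: one strand from every boundary vertex, with states `J`. -/
def start (J : Fin n → SignType) : Stage n V :=
  ⟨List.ofFn fun i => (.inl i, J i), ∅⟩

/-- The end of the growth algorithm: nothing is dangling and all of the web has been drawn. -/
def finish [Fintype V] : Stage n V := ⟨[], Finset.univ⟩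

/-- `J` is a KK-labeling of `D`: with the sign string `S` of `D` it forms a dominant sign and state
string, from which the growth algorithm produces `D`. -/
def IsKKLabeling [Fintype V] [DecidableEq V] (D : SL3Web n V) (J : Fin n → SignType) : Prop :=
  IsDominant (fun i => D.black (.inl i)) J ∧
    Relation.ReflTransGen D.GrowthStep (start J) finish

/-- `c` is the edge coloring determined by the KK-labeling `J`: it is proper, and whenever a strand
occurs in a growth of `D` from `J`, the color of its edge is its state if its sign is `+`, and the
negative of its state if its sign is `-`. -/
def IsKKColoring [Fintype V] [DecidableEq V] (D : SL3Web n V) (J : Fin n → SignType)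
    (c : HalfEdge n V → SignType) : Prop :=
  D.IsProper c ∧ ∀ T : Stage n V, Relation.ReflTransGen D.GrowthStep (start J) T →
    Relation.ReflTransGen D.GrowthStep T finish →
      ∀ d j, (d, j) ∈ T.strands → c d = if D.black d.base then j else -j

/-! ### The invariant and its leading term -/

/-- The sign of the permutation formed by the colors at `v` in clockwise order, where
`-1, 0, 1` is positive. (Used for proper colorings only.) -/
def vertexSign (c : HalfEdge n V → SignType) (v : V) : ℤ :=
  if (c (.inr (v, 0)), c (.inr (v, 1)), c (.inr (v, 2))) ∈
      ([(-1, 0, 1), (0, 1, -1), (1, -1, 0)] : List (SignType × SignType × SignType))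
  then 1 else -1

/-- The product of the signs of a coloring at all internal vertices. -/
def coloringSign [Fintype V] (c : HalfEdge n V → SignType) : ℤ := ∏ v : V, vertexSign c v

/-- The exponent vector of the monomial of a coloring. The variable `(i, a)` is the coordinate of
color `a` of the vector (`i` black) or of the covector (`i` white) at the boundary vertex `i`. -/
noncomputable def exponent (c : HalfEdge n V → SignType) : Fin n × SignType →₀ ℕ :=
  ∑ i : Fin n, Finsupp.single (i, c (.inl i)) 1

open Classical in
/-- The invariant `[D]`: the sum over all proper edge colorings of sign times monomial. -/
noncomputable def invariant [Fintype V] (D : SL3Web n V) : MvPolynomial (Fin n × SignType) ℂ :=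
  ∑ c : HalfEdge n V → SignType with D.IsProper c,
    MvPolynomial.monomial (exponent c) (coloringSign c : ℂ)

/-- The order of the variables: first by the number of the boundary vertex, then
`x_{-1} < x_0 < x_1` at a black vertex and `y_1 < y_0 < y_{-1}` at a white one. -/
def VarLT (D : SL3Web n V) (x y : Fin n × SignType) : Prop :=
  x.1 < y.1 ∨ x.1 = y.1 ∧ if D.black (.inl x.1) then x.2 < y.2 else y.2 < x.2

/-- The graded reverse lexicographic order on exponent vectors: `α < β` if the total degree of `α`
is smaller, or the total degrees are equal and at the smallest variable where the exponents differ
that of `α` is larger. -/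
def GrevlexLT (D : SL3Web n V) (α β : Fin n × SignType →₀ ℕ) : Prop :=
  α.degree < β.degree ∨ α.degree = β.degree ∧
    ∃ z, (∀ y, D.VarLT y z → α y = β y) ∧ β z < α z

/-- `m` is the leading monomial of `f`: the largest of the monomials that occur in `f`. -/
def IsLeadingMonomial (D : SL3Web n V) (f : MvPolynomial (Fin n × SignType) ℂ)
    (m : Fin n × SignType →₀ ℕ) : Prop :=
  m ∈ f.support ∧ ∀ m' ∈ f.support, m' ≠ m → D.GrevlexLT m' m

end SL3Web

open scoped BigOperators

namespace SL3Web

variable {n : ℕ} {V : Type*}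

/-! ### Half-edges -/

/-! The growth rules form a rewriting system on rows of strands; `Completes l U` says that the part
of the web below the row `l` can be drawn to the end. Existence of a labeling and optimality of its
coloring are proved independently, and uniqueness follows from optimality.

Existence. Forget the states. As long as strands are dangling, Euler's formula and a degree count
over the faces (a face away from the row has at least six sides, by non-ellipticity) force a cap, a
Y or an H to hang from two neighboring strands (`exists_peel`). Remove this piece, label the rest by
induction, and put the piece back (`Peel.exists_completes`). States can always be carried up through
a cap or a Y, but an H admits only three pairs of bottom states. Pairs that form a descent do not
occur: the system is confluent (`Completes.confluent`), so a rule would apply directly below the H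
and close a double edge or a 4-cycle. The remaining pairs `1, 1` and `-1, -1` are carried up
unchanged, and the growth is rearranged into a legal one by `Completes.aitch_one_one` and its mirror
image.

Optimality. Every edge carries a weight, conserved by each rule, both for the states and for an
arbitrary proper coloring, since the weights at an internal vertex sum to zero. Going up through the
growth, one finds that on every initial segment of a row the states have the largest weight, in the
root order, among all proper colorings (`Completes.rootLE`). Hence a coloring that first deviates
from the states at boundary vertex `i` has a lower state there, that is, a larger color. The same
bound settles the only choice left open when a coloring is carried down, at an H under states `0,
0`; so the boundary states determine the whole coloring (`Completes.eq_of_realizes`).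

A coloring with the given states exists because each piece can be colored over the part below it.
Being strictly smaller than all others, it forces uniqueness of the labeling, and its monomial,
which records the boundary word, cannot cancel and leads. -/

/-- The color of the vertex at which a half-edge is based. -/
def col (D : SL3Web n V) (d : HalfEdge n V) : Bool := D.black d.base

theorem col_mate (D : SL3Web n V) (d : HalfEdge n V) : D.col (D.mate d) = !D.col d :=
  D.black_mate d

theorem col_inr (D : SL3Web n V) (v : V) (k l : Fin 3) :
    D.col (.inr (v, k)) = D.col (.inr (v, l)) := rfl

theorem col_eq_not {D : SL3Web n V} {d e : HalfEdge n V} (h : D.mate d = e) :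
    D.col e = !D.col d := h ▸ D.col_mate d

theorem mate_eq_comm {D : SL3Web n V} {d e : HalfEdge n V} (h : D.mate d = e) : D.mate e = d := by
  rw [← h, D.mate_mate]

theorem mate_injective (D : SL3Web n V) : Function.Injective D.mate :=
  D.matePerm.injective

theorem adj_of_mate {D : SL3Web n V} {v w : V} {k l : Fin 3}
    (h : D.mate (.inr (v, k)) = .inr (w, l)) : D.Adj (.inr v) (.inr w) :=
  ⟨.inr (v, k), rfl, by rw [h]; rfl⟩

theorem fin3_add_one_one (k : Fin 3) : k + 1 + 1 = k + 2 := by fin_cases k <;> rfl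
theorem fin3_add_one_two (k : Fin 3) : k + 1 + 2 = k := by fin_cases k <;> rfl
theorem fin3_add_two_one (k : Fin 3) : k + 2 + 1 = k := by fin_cases k <;> rfl
theorem fin3_cases (k j : Fin 3) : j = k ∨ j = k + 1 ∨ j = k + 2 := by
  fin_cases k <;> fin_cases j <;> simp
theorem fin3_ne_add_one (k : Fin 3) : k ≠ k + 1 := by fin_cases k <;> decide
theorem fin3_ne_add_two (k : Fin 3) : k ≠ k + 2 := by fin_cases k <;> decide
theorem fin3_add_one_ne_add_two (k : Fin 3) : k + 1 ≠ k + 2 := by fin_cases k <;> decide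

theorem ruleY_iff {a b s : SignType} : RuleY a b s ↔
    a = 1 ∧ b = 0 ∧ s = 1 ∨ a = 0 ∧ b = -1 ∧ s = -1 ∨ a = 1 ∧ b = -1 ∧ s = 0 := by
  constructor
  · intro h
    induction h <;> simp
  · rintro (⟨rfl, rfl, rfl⟩ | ⟨rfl, rfl, rfl⟩ | ⟨rfl, rfl, rfl⟩)
    exacts [.one_zero, .zero_neg, .one_neg]

theorem ruleH_iff {a b s t : SignType} : RuleH a b s t ↔
    a = 1 ∧ b = 0 ∧ s = 0 ∧ t = 1 ∨ a = 0 ∧ b = 0 ∧ s = -1 ∧ t = 1 ∨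
      a = 0 ∧ b = -1 ∧ s = -1 ∧ t = 0 := by
  constructor
  · intro h
    induction h <;> simp
  · rintro (⟨rfl, rfl, rfl, rfl⟩ | ⟨rfl, rfl, rfl, rfl⟩ | ⟨rfl, rfl, rfl, rfl⟩)
    exacts [.one_zero, .zero_zero, .zero_neg]

/-! ### Local form of the growth rules -/

/-- A strand of the growth algorithm: the upper half-edge of its edge, and its state. -/
abbrev Strand (n : ℕ) (V : Type*) := HalfEdge n V × SignType

/-- The growth rule applied to the neighboring strands `x`, `y` replaces them by the list `M` of
strands and draws the set `W` of vertices. -/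
inductive Rewrite [DecidableEq V] (D : SL3Web n V) :
    Strand n V → Strand n V → List (Strand n V) → Finset V → Prop
  | cap (d e : HalfEdge n V) (a b : SignType) (ha : a = 1) (hb : b = -1) (h : D.mate d = e) :
      Rewrite D (d, a) (e, b) [] ∅
  | tri (d e : HalfEdge n V) (v : V) (k : Fin 3) (a b s : SignType) (hs : RuleY a b s)
      (hd : D.mate d = .inr (v, k)) (he : D.mate e = .inr (v, k + 1)) :
      Rewrite D (d, a) (e, b) [(.inr (v, k + 2), s)] {v}
  | aitch (d e : HalfEdge n V) (v w : V) (k l : Fin 3) (a b s t : SignType) (hs : RuleH a b s t)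
      (hd : D.mate d = .inr (v, k)) (he : D.mate e = .inr (w, l))
      (hvw : D.mate (.inr (v, k + 1)) = .inr (w, l + 2)) :
      Rewrite D (d, a) (e, b) [(.inr (v, k + 2), s), (.inr (w, l + 1), t)] {v, w}

/-- The growth algorithm, with strands `l` dangling and the vertices in `U` drawn, can be
completed. -/
inductive Completes [Fintype V] [DecidableEq V] (D : SL3Web n V) :
    List (Strand n V) → Finset V → Prop
  | done : Completes D [] Finset.univ
  | step (L R : List (Strand n V)) (x y : Strand n V) (M : List (Strand n V)) (W U : Finset V)
      (h : Rewrite D x y M W) (hU : Disjoint U W) (hc : Completes D (L ++ M ++ R) (W ∪ U)) :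
      Completes D (L ++ x :: y :: R) U

variable [DecidableEq V]

theorem growthStep_iff (D : SL3Web n V) (S T : Stage n V) : D.GrowthStep S T ↔
    ∃ L R x y M W, D.Rewrite x y M W ∧ Disjoint S.drawn W ∧ S.strands = L ++ x :: y :: R ∧
      T = ⟨L ++ M ++ R, W ∪ S.drawn⟩ := by
  constructor
  · rintro (⟨L, R, U, d, e, h⟩ | ⟨L, R, U, d, e, v, k, a, b, s, hs, hv, hd, he⟩ |
      ⟨L, R, U, d, e, v, w, k, l, a, b, s, t, hs, hv, hw, hd, he, hvw⟩)
    · exact ⟨L, R, _, _, _, _, .cap d e 1 (-1) rfl rfl h, by simp, rfl, by simp⟩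
    · exact ⟨L, R, _, _, _, _, .tri d e v k a b s hs hd he, by simpa using hv, rfl, by
        simp⟩
    · exact ⟨L, R, _, _, _, _, .aitch d e v w k l a b s t hs hd he hvw, by simp [hv, hw], rfl, by
        simp⟩
  · rcases S with ⟨l, U⟩
    rintro ⟨L, R, x, y, M, W, h, hU, hl, rfl⟩
    dsimp only at hl hU
    subst hl
    cases h with
    | cap d e a b ha hb h =>
      subst ha hb
      simpa using GrowthStep.capU L R U d e h
    | tri d e v k a b s hs hd he =>
      simpa using GrowthStep.stepY L R U d e v k a b s hs (by simpa using hU) hd he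
    | aitch d e v w k l a b s t hs hd he hvw =>
      simp only [Finset.disjoint_insert_right, Finset.disjoint_singleton_right] at hU
      simpa using
        GrowthStep.stepH L R U d e v w k l a b s t hs hU.1 hU.2 hd he hvw

theorem completes_iff [Fintype V] (D : SL3Web n V) (T : Stage n V) :
    D.Completes T.strands T.drawn ↔ Relation.ReflTransGen D.GrowthStep T finish := by
  constructor
  · rcases T with ⟨l, U⟩
    intro h
    dsimp only at h
    induction h with
    | done => exact .refl
    | step L R x y M W U h hU hc ih =>
      exact .head ((D.growthStep_iff _ _).2 ⟨L, R, x, y, M, W, h, hU, rfl, rfl⟩) ih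
  · intro h
    induction h using Relation.ReflTransGen.head_induction_on with
    | refl => exact .done
    | head h _ ih =>
      obtain ⟨L, R, x, y, M, W, hr, hU, hl, rfl⟩ := (D.growthStep_iff _ _).1 h
      rw [hl]
      exact .step L R x y M W _ hr hU ih

/-! ### Confluence -/

/-- Two neighboring strands to which a growth rule should apply, judging by signs and states. -/
def Descent (D : SL3Web n V) (x y : Strand n V) : Prop :=
  y.2 < x.2 ∨ x.2 = 0 ∧ y.2 = 0 ∧ D.col x.1 ≠ D.col y.1

/-- All descents in the list `l` of strands can be removed by a growth rule in a completion. -/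
def Confluent [Fintype V] (D : SL3Web n V) (l : List (Strand n V)) (U : Finset V) : Prop :=
  ∀ L x y R, l = L ++ x :: y :: R → D.Descent x y →
    ∃ M W, D.Rewrite x y M W ∧ Disjoint U W ∧ D.Completes (L ++ M ++ R) (W ∪ U)

theorem Rewrite.right_ne_one {D : SL3Web n V} {x y : Strand n V} {M W} (h : D.Rewrite x y M W) :
    y.2 ≠ 1 := by
  cases h with
  | cap d e a b ha hb h => subst hb; simp
  | tri d e v k a b s hs hd he => rcases ruleY_iff.1 hs with h | h | h <;> simp [h]
  | aitch d e v w k l a b s t hs hd he hvw =>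
    rcases ruleH_iff.1 hs with h | h | h <;> simp [h]

/-- Two neighboring pairs in a row are equal, overlap in one strand on either side, or are disjoint.
These are the cases to distinguish when two rules compete. -/
theorem append_pair_eq {α : Type*} {L R L' R' : List α} {x y x' y' : α}
    (h : L ++ x :: y :: R = L' ++ x' :: y' :: R') :
    (L = L' ∧ x = x' ∧ y = y' ∧ R = R') ∨
    (L' = L ++ [x] ∧ x' = y ∧ R = y' :: R') ∨
    (L = L' ++ [x'] ∧ y' = x ∧ R' = y :: R) ∨
    (∃ M, L' = L ++ x :: y :: M ∧ R = M ++ x' :: y' :: R') ∨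
    (∃ M, L = L' ++ x' :: y' :: M ∧ R' = M ++ x :: y :: R) := by
  rcases List.append_eq_append_iff.1 h with ⟨A, h1, h2⟩ | ⟨A, h1, h2⟩
  · rcases A with _ | ⟨a, _ | ⟨b, A⟩⟩ <;> simp at h1 h2
    · simp_all
    · simp_all
    · obtain ⟨rfl, rfl, rfl⟩ := h2
      simp [h1]
  · rcases A with _ | ⟨a, _ | ⟨b, A⟩⟩ <;> simp at h1 h2
    · simp_all
    · simp_all
    · obtain ⟨rfl, rfl, rfl⟩ := h2
      simp [h1]

theorem Completes.step' [Fintype V] {D : SL3Web n V} {L R l l' : List (Strand n V)}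
    {x y : Strand n V} {M : List (Strand n V)} {W U U' : Finset V}
    (h : D.Rewrite x y M W) (hU : Disjoint U W) (hc : D.Completes l' U')
    (hl' : l' = L ++ M ++ R) (hU' : U' = W ∪ U) (hl : l = L ++ x :: y :: R) :
    D.Completes l U := by
  subst hl' hU' hl
  exact .step L R x y M W U h hU hc

end SL3Web

/-! ### Critical pairs: two overlapping rules -/

namespace SL3Web

variable {n : ℕ} {V : Type*} [DecidableEq V]

omit [DecidableEq V] in
theorem Descent.of_one {D : SL3Web n V} {x y : Strand n V} (hx : x.2 = 1) (hy : y.2 ≠ 1) :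
    D.Descent x y := by
  left
  rw [hx]
  exact (by decide : ∀ b : SignType, b ≠ 1 → b < 1) _ hy

omit [DecidableEq V] in
theorem Descent.left_ne {D : SL3Web n V} {x y : Strand n V} (h : D.Descent x y) : x.2 ≠ -1 := by
  rcases h with h | h
  · exact (by decide : ∀ a b : SignType, b < a → a ≠ -1) _ _ h
  · simp [h.1]

omit [DecidableEq V] in
theorem Descent.right_ne {D : SL3Web n V} {x y : Strand n V} (h : D.Descent x y) : y.2 ≠ 1 := by
  rcases h with h | h
  · exact (by decide : ∀ a b : SignType, b < a → b ≠ 1) _ _ h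
  · simp [h.2.1]

/-- The critical pair in which a rule consumes `p`, `x` while `x`, `y` is a descent. As `x.2 ≠ -1`,
the rule is a Y or an H with `x.2 = 0`, and its last new strand has state `1`. This strand and `y`
form a descent again, which can be removed by `hc`. The same piece of web is then redrawn from `x`,
`y`: Y, cap becomes Y, cap; Y, Y becomes H, cap; H, cap becomes Y, Y; and H, Y becomes H, Y. -/
theorem Rewrite.confluent_left [Fintype V] {D : SL3Web n V} {L R : List (Strand n V)}
    {p x y : Strand n V} {M : List (Strand n V)} {W U : Finset V} (h : D.Rewrite p x M W)
    (hU : Disjoint U W) (hc : D.Confluent (L ++ M ++ y :: R) (W ∪ U)) (hxy : D.Descent x y) :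
    ∃ M' W', D.Rewrite x y M' W' ∧ Disjoint U W' ∧ D.Completes (L ++ p :: M' ++ R) (W' ∪ U) := by
  cases h with
  | cap d e a b ha hb h =>
    exact absurd hb hxy.left_ne
  | tri d e v k a b s hs hd he =>
    have hb : b = 0 := by
      rcases ruleY_iff.1 hs with h | h | h
      · exact h.2.1
      all_goals exact absurd h.2.1 hxy.left_ne
    have has : a = 1 ∧ s = 1 := by
      rcases ruleY_iff.1 hs with h | h | h <;> simp_all
    obtain ⟨rfl, rfl⟩ := has
    subst hb
    obtain ⟨M2, W2, h2, hU2, hc2⟩ := hc L (.inr (v, k + 2), 1) y R (by simp) (.of_one rfl hxy.right_ne)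
    generalize hz : ((.inr (v, k + 2), 1) : Strand n V) = z at h2
    cases h2 with
    | cap d' e' a' b' ha' hb' h' =>
      obtain ⟨rfl, rfl⟩ := Prod.mk.inj hz
      subst hb'
      refine ⟨[(.inr (v, k + 1 + 2), -1)], {v}, .tri e e' v (k + 1) 0 (-1) (-1) .zero_neg he ?_,
        hU, ?_⟩
      · rw [fin3_add_one_one]; exact mate_eq_comm h'
      · refine Completes.step' (L := L) (R := R) (.cap d (.inr (v, k + 1 + 2)) 1 (-1) rfl rfl ?_) (by simp) hc2
          (by simp) (by simp) (by simp)
        rw [fin3_add_one_two, hd]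
    | tri d' e' w l a' b' s' hs' hd' he' =>
      obtain ⟨rfl, rfl⟩ := Prod.mk.inj hz
      have hvw : v ≠ w := by
        rintro rfl
        have h1 := D.col_mate (.inr (v, k + 2))
        rw [hd'] at h1
        rw [D.col_inr v l (k + 2)] at h1
        simp at h1
      refine ⟨[(.inr (v, k + 1 + 2), -1), (.inr (w, l + 1 + 1), s')], {v, w},
        .aitch e e' v w (k + 1) (l + 1) 0 b' (-1) s' ?_ he he' ?_, ?_, ?_⟩
      · rcases ruleY_iff.1 hs' with h | h | h <;> obtain ⟨h1, rfl, rfl⟩ := h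
        · exact .zero_zero
        · simp at h1
        · exact .zero_neg
      · rw [fin3_add_one_one, fin3_add_one_two, hd']
      · simp at hU hU2 ⊢
        tauto
      · refine Completes.step' (L := L) (R := (.inr (w, l + 2), s') :: R)
          (.cap d (.inr (v, k + 1 + 2)) 1 (-1) rfl rfl ?_) (by simp) hc2
          (by simp) ?_ (by simp [fin3_add_one_one])
        · rw [fin3_add_one_two, hd]
        · ext; simp
    | aitch d' e' w u l i a' b' s' t' hs' hd' he' hwu =>
      obtain ⟨rfl, rfl⟩ := Prod.mk.inj hz
      have hb : b' = 0 := by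
        rcases ruleH_iff.1 hs' with h | h | h
        · exact h.2.1
        all_goals simp at h
      subst hb
      -- An H as second rule needs `y.2 = 0`, so the descent `x`, `y` has states `0, 0` and
      -- different signs; but the bipartition makes the two signs equal.
      rcases hxy with hxy | ⟨-, -, hxy⟩
      · exact absurd hxy (by dsimp only; decide)
      · exfalso
        have h1 := col_eq_not he
        have h2 := col_eq_not he'
        have h3 := col_eq_not hd'
        have h4 := col_eq_not hwu
        rw [D.col_inr v _ k] at h1 h3
        rw [D.col_inr u _ i, D.col_inr w _ l] at h4
        simp_all
  | aitch d e v w k l a b s t hs hd he hvw =>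
    have hb : b = 0 := by
      rcases ruleH_iff.1 hs with h | h | h
      · exact h.2.1
      · exact h.2.1
      · exact absurd h.2.1 hxy.left_ne
    subst hb
    have ht : t = 1 := by
      rcases ruleH_iff.1 hs with h | h | h <;> simp_all
    subst ht
    -- After redrawing, the horizontal edge is a strand of state `-1` hanging from `w`, and it meets
    -- `d` in a Y at `v`.
    have has : RuleY a (-1) s := by
      rcases ruleH_iff.1 hs with h | h | h
      · obtain ⟨rfl, -, rfl, -⟩ := h
        exact .one_neg
      · obtain ⟨rfl, -, rfl, -⟩ := h
        exact .zero_neg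
      · simp at h
    have hvw' := mate_eq_comm hvw
    obtain ⟨M2, W2, h2, hU2, hc2⟩ := hc (L ++ [(.inr (v, k + 2), s)]) (.inr (w, l + 1), 1) y R
      (by simp) (.of_one rfl hxy.right_ne)
    have hvw0 : v ≠ w := by
      rintro rfl
      have h1 := col_eq_not hvw
      rw [D.col_inr v _ (k + 1)] at h1
      simp at h1
    simp only [Finset.disjoint_insert_right, Finset.disjoint_singleton_right,
      Finset.disjoint_union_left, Finset.disjoint_insert_left, Finset.disjoint_singleton_left]
      at hU hU2
    generalize hz : ((.inr (w, l + 1), 1) : Strand n V) = z at h2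
    cases h2 with
    | cap d' e' a' b' ha' hb' h' =>
      obtain ⟨rfl, rfl⟩ := Prod.mk.inj hz
      subst hb'
      refine ⟨[(.inr (w, l + 2), -1)], {w}, .tri e e' w l 0 (-1) (-1) .zero_neg he
        (mate_eq_comm h'), by simpa using hU.2, ?_⟩
      refine Completes.step' (L := L) (R := R) (.tri d _ v k a (-1) s has hd hvw') ?_ hc2 (by simp)
        (by ext; simp; tauto) (by simp)
      simpa [hvw0] using hU.1
    | tri d' e' u i a' b' s' hs' hd' he' =>
      obtain ⟨rfl, rfl⟩ := Prod.mk.inj hz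
      refine ⟨[(.inr (w, l + 2), -1), (.inr (u, i + 1 + 1), s')], {w, u},
        .aitch e e' w u l (i + 1) 0 b' (-1) s' ?_ he he' ?_, ?_, ?_⟩
      · rcases ruleY_iff.1 hs' with h | h | h <;> obtain ⟨h1, rfl, rfl⟩ := h
        · exact .zero_zero
        · simp at h1
        · exact .zero_neg
      · rw [fin3_add_one_two, hd']
      · simp at hU2 ⊢
        tauto
      · refine Completes.step' (L := L) (R := (.inr (u, i + 2), s') :: R)
          (.tri d _ v k a (-1) s has hd hvw') ?_ hc2 (by simp) ?_ (by simp [fin3_add_one_one])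
        · simp at hU2 ⊢
          tauto
        · ext; simp; tauto
    | aitch d' e' u u' i j a' b' s' t' hs' hd' he' hwu =>
      obtain ⟨rfl, rfl⟩ := Prod.mk.inj hz
      have hb : b' = 0 := by
        rcases ruleH_iff.1 hs' with h | h | h
        · exact h.2.1
        all_goals simp at h
      subst hb
      rcases hxy with hxy | ⟨-, -, hxy⟩
      · exact absurd hxy (by dsimp only; decide)
      · exfalso
        have h1 := col_eq_not he
        have h2 := col_eq_not he'
        have h3 := col_eq_not hd'
        have h4 := col_eq_not hwu
        rw [D.col_inr w _ l] at h3 h1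
        rw [D.col_inr u' _ j, D.col_inr u _ i] at h4
        simp_all

/-! ### Mirror images -/

/-- The mirror image of a half-edge. -/
def flip (d : HalfEdge n V) : HalfEdge n V := Sum.map id (Prod.map id Neg.neg) d

omit [DecidableEq V] in
@[simp] theorem flip_flip (d : HalfEdge n V) : flip (flip d) = d := by
  rcases d with i | ⟨v, k⟩ <;> simp [flip]

omit [DecidableEq V] in
@[simp] theorem flip_inr (v : V) (k : Fin 3) :
    flip (.inr (v, k) : HalfEdge n V) = .inr (v, -k) := rfl

omit [DecidableEq V] in
@[simp] theorem base_flip (d : HalfEdge n V) : (flip d).base = d.base := by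
  rcases d with i | ⟨v, k⟩ <;> rfl

/-- The mirror image of a web, with the numbering of the boundary vertices unchanged. -/
def mirror (D : SL3Web n V) : SL3Web n V where
  black := D.black
  mate d := flip (D.mate (flip d))
  mate_mate d := by simp [D.mate_mate]
  black_mate d := by simp [D.black_mate]

omit [DecidableEq V] in
theorem mirror_mirror (D : SL3Web n V) : D.mirror.mirror = D := by
  cases D
  simp [mirror]

omit [DecidableEq V] in
@[simp] theorem mirror_mate_flip (D : SL3Web n V) (d : HalfEdge n V) :
    D.mirror.mate (flip d) = flip (D.mate d) := by
  simp [mirror]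

omit [DecidableEq V] in
@[simp] theorem mirror_col_flip (D : SL3Web n V) (d : HalfEdge n V) :
    D.mirror.col (flip d) = D.col d := by
  simp [mirror, col]

omit [DecidableEq V] in
theorem mirror_adj (D : SL3Web n V) {u w : Fin n ⊕ V} : D.mirror.Adj u w ↔ D.Adj u w := by
  constructor
  · rintro ⟨d, rfl, rfl⟩
    exact ⟨flip d, by simp, by simp [mirror]⟩
  · rintro ⟨d, rfl, rfl⟩
    exact ⟨flip d, by simp, by simp⟩

omit [DecidableEq V] in
theorem IsNonElliptic.mirror {D : SL3Web n V} (h : D.IsNonElliptic) : D.mirror.IsNonElliptic := by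
  refine ⟨fun d e h1 h2 => ?_, fun p q r s hpr hqs => by simpa [mirror_adj] using h.2 p q r s hpr hqs⟩
  have := h.1 (flip d) (flip e) (by simpa using h1) (by simpa [SL3Web.mirror] using h2)
  simpa using congrArg flip this

/-- The mirror image of a strand. -/
def flipStrand (x : Strand n V) : Strand n V := (flip x.1, -x.2)

omit [DecidableEq V] in
@[simp] theorem flipStrand_flipStrand (x : Strand n V) : flipStrand (flipStrand x) = x := by
  simp [flipStrand]

/-- The mirror image of a row of strands. -/
def flipRow (l : List (Strand n V)) : List (Strand n V) := (l.map flipStrand).reverse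

omit [DecidableEq V] in
@[simp] theorem flipRow_flipRow (l : List (Strand n V)) : flipRow (flipRow l) = l := by
  simp [flipRow, Function.comp_def]

omit [DecidableEq V] in
@[simp] theorem flipRow_append (l l' : List (Strand n V)) :
    flipRow (l ++ l') = flipRow l' ++ flipRow l := by
  simp [flipRow]

omit [DecidableEq V] in
@[simp] theorem flipRow_cons (x : Strand n V) (l : List (Strand n V)) :
    flipRow (x :: l) = flipRow l ++ [flipStrand x] := by
  simp [flipRow]

omit [DecidableEq V] in
@[simp] theorem flipRow_nil : flipRow ([] : List (Strand n V)) = [] := rfl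

/-- Reversing the row and negating all states permutes the growth rules. Negating the indices in
`Fin 3` reverses the cyclic order at each vertex. -/
theorem Rewrite.mirror {D : SL3Web n V} {x y : Strand n V} {M W} (h : D.Rewrite x y M W) :
    D.mirror.Rewrite (flipStrand y) (flipStrand x) (flipRow M) W := by
  cases h with
  | cap d e a b ha hb h =>
    subst ha hb
    exact .cap _ _ _ _ (by simp) rfl (by simp [mate_eq_comm h])
  | tri d e v k a b s hs hd he =>
    have h1 : -(k + 2) = -(k + 1) + 2 := by clear * -; revert k; decide
    have h2 : -k = -(k + 1) + 1 := by clear * -; revert k; decide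
    have := Rewrite.tri (D := D.mirror) (flip e) (flip d) v (-(k + 1)) (-b) (-a) (-s)
      (by rcases ruleY_iff.1 hs with ⟨rfl, rfl, rfl⟩ | ⟨rfl, rfl, rfl⟩ | ⟨rfl, rfl, rfl⟩ <;>
            simp [ruleY_iff])
      (by simp [he]) (by rw [mirror_mate_flip, hd, flip_inr, ← h2])
    rw [← h1] at this
    exact this
  | aitch d e v w k l a b s t hs hd he hvw =>
    have h1 : -(l + 1) = -l + 2 := by clear * -; revert l; decide
    have h2 : -(k + 2) = -k + 1 := by clear * -; revert k; decide
    have h3 : -(l + 2) = -l + 1 := by clear * -; revert l; decide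
    have h4 : -(k + 1) = -k + 2 := by clear * -; revert k; decide
    have h5 : D.mirror.mate (.inr (w, -l + 1)) = .inr (v, -k + 2) := by
      rw [← h3, ← flip_inr, mirror_mate_flip, mate_eq_comm hvw, flip_inr, h4]
    have := Rewrite.aitch (D := D.mirror) (flip e) (flip d) w v (-l) (-k) (-b) (-a) (-t) (-s)
      (by rcases ruleH_iff.1 hs with ⟨rfl, rfl, rfl, rfl⟩ | ⟨rfl, rfl, rfl, rfl⟩ |
            ⟨rfl, rfl, rfl, rfl⟩ <;> simp [ruleH_iff])
      (by simp [he]) (by simp [hd]) h5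
    rw [Finset.pair_comm]
    rw [← h1, ← h2] at this
    exact this

theorem Completes.mirror [Fintype V] {D : SL3Web n V} {l : List (Strand n V)} {U : Finset V}
    (h : D.Completes l U) : D.mirror.Completes (flipRow l) U := by
  induction h with
  | done => exact .done
  | step L R x y M W U h hU hc ih =>
    exact Completes.step' (L := flipRow R) (R := flipRow L) h.mirror hU ih (by simp) rfl (by simp)

omit [DecidableEq V] in
theorem Descent.mirror {D : SL3Web n V} {x y : Strand n V} (h : D.Descent x y) :
    D.mirror.Descent (flipStrand y) (flipStrand x) := by
  rcases h with h | ⟨h1, h2, h3⟩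
  · left
    revert h
    simp only [flipStrand]
    generalize x.2 = a
    generalize y.2 = b
    revert a b
    decide
  · right
    simpa [flipStrand, h1, h2] using h3.symm

theorem Confluent.mirror [Fintype V] {D : SL3Web n V} {l : List (Strand n V)} {U : Finset V}
    (h : D.Confluent l U) : D.mirror.Confluent (flipRow l) U := by
  intro L x y R hl hxy
  obtain ⟨M, W, h1, h2, h3⟩ := h (flipRow R) (flipStrand y) (flipStrand x) (flipRow L)
    (by simpa using congrArg flipRow hl) (by simpa [mirror_mirror] using hxy.mirror)
  exact ⟨flipRow M, W, by simpa using h1.mirror, h2, by simpa using h3.mirror⟩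

/-! ### Confluence from the two critical pairs -/

theorem Rewrite.confluent_right [Fintype V] {D : SL3Web n V} {L R : List (Strand n V)}
    {x y p : Strand n V} {M : List (Strand n V)} {W U : Finset V} (h : D.Rewrite y p M W)
    (hU : Disjoint U W) (hc : D.Confluent (L ++ x :: M ++ R) (W ∪ U)) (hxy : D.Descent x y) :
    ∃ M' W', D.Rewrite x y M' W' ∧ Disjoint U W' ∧ D.Completes (L ++ M' ++ p :: R) (W' ∪ U) := by
  obtain ⟨M', W', h1, h2, h3⟩ := h.mirror.confluent_left (L := flipRow R) (R := flipRow L) hU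
    (by simpa using hc.mirror) hxy.mirror
  exact ⟨flipRow M', W', by simpa [mirror_mirror] using h1.mirror, h2,
    by simpa [mirror_mirror] using h3.mirror⟩

/-- Induction on the completion: its first rule acts on the descent itself, or forms a critical pair
with it, or is disjoint from it and commutes with the rule found by induction. -/
theorem Completes.confluent [Fintype V] {D : SL3Web n V} {l : List (Strand n V)} {U : Finset V}
    (h : D.Completes l U) : D.Confluent l U := by
  induction h with
  | done => intro L x y R h; simp at h
  | step L R x y M W U h hU hc ih =>
    intro L' x' y' R' hl hxy
    rcases append_pair_eq hl with ⟨rfl, rfl, rfl, rfl⟩ | ⟨rfl, rfl, rfl⟩ | ⟨rfl, rfl, rfl⟩ |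
      ⟨N, rfl, rfl⟩ | ⟨N, rfl, rfl⟩
    · exact ⟨M, W, h, hU, hc⟩
    · obtain ⟨M', W', h1, h2, h3⟩ := h.confluent_left hU ih hxy
      exact ⟨M', W', h1, h2, by simpa using h3⟩
    · obtain ⟨M', W', h1, h2, h3⟩ := h.confluent_right (L := L') (x := x') hU (by simpa using ih) hxy
      exact ⟨M', W', h1, h2, by simpa using h3⟩
    · obtain ⟨M', W', h1, h2, h3⟩ := ih (L ++ M ++ N) x' y' R' (by simp) hxy
      rw [Finset.disjoint_union_left] at h2
      refine ⟨M', W', h1, h2.2, Completes.step' (L := L) (R := N ++ M' ++ R') h ?_ h3 (by simp)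
        (by ext; simp; tauto) (by simp)⟩
      rw [Finset.disjoint_union_left]
      exact ⟨h2.1.symm, hU⟩
    · obtain ⟨M', W', h1, h2, h3⟩ := ih L' x' y' (N ++ M ++ R) (by simp) hxy
      rw [Finset.disjoint_union_left] at h2
      refine ⟨M', W', h1, h2.2, Completes.step' (L := L' ++ M' ++ N) (R := R) h ?_ h3 (by simp)
        (by ext; simp; tauto) (by simp)⟩
      rw [Finset.disjoint_union_left]
      exact ⟨h2.1.symm, hU⟩

end SL3Web

/-! ### An H above two strands of the same extreme state -/

namespace SL3Web

variable {n : ℕ} {V : Type*} [DecidableEq V]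

/-- An `H` drawn over two strands of state `1` does not disturb the growth of a non-elliptic web. -/
theorem Completes.aitch_one_one [Fintype V] {D : SL3Web n V} (hD : D.IsNonElliptic)
    {v w : V} {k l : Fin 3} {d e : HalfEdge n V} (hd : D.mate d = .inr (v, k))
    (he : D.mate e = .inr (w, l)) (hvw : D.mate (.inr (v, k + 1)) = .inr (w, l + 2))
    {r : List (Strand n V)} {U' : Finset V} (h : D.Completes r U') :
    ∀ (L R : List (Strand n V)) (U : Finset V), Disjoint U {v, w} → U' = {v, w} ∪ U →
      r = L ++ (.inr (v, k + 2), 1) :: (.inr (w, l + 1), 1) :: R →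
      D.Completes (L ++ (d, 1) :: (e, 1) :: R) U := by
  have hwv := mate_eq_comm hvw
  have hvw0 : v ≠ w := by
    rintro rfl
    have h1 := col_eq_not hvw
    rw [D.col_inr v _ (k + 1)] at h1
    simp at h1
  induction h with
  | done => intro L R U _ _ h; simp at h
  | step L R x y M W U' h hU hc ih =>
    rintro L' R' U hUvw rfl hl
    have hU0 := hU
    simp only [Finset.disjoint_insert_right, Finset.disjoint_singleton_right,
      Finset.disjoint_union_left, Finset.disjoint_insert_left, Finset.disjoint_singleton_left]
      at hU hUvw
    -- a strand of state `0` next to `v` would close a 4-cycle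
    have key : ∀ (u : V) (j : Fin 3) (R₀ : List (Strand n V)) (U₀ : Finset V), v ∈ U₀ → w ∈ U₀ →
        u ∉ ({v, w} : Finset V) → D.mate (.inr (w, l + 1)) = .inr (u, j) →
        D.Completes (L' ++ (.inr (v, k + 2), 1) :: (.inr (u, j + 2), 0) :: R₀) U₀ → False := by
      intro u j R₀ U₀ hv hw hu hwu hc
      have h1 := col_eq_not hwu
      have h2 := col_eq_not hvw
      rw [D.col_inr u _ (j + 2), D.col_inr w _ (l + 2), h2, D.col_inr v _ (k + 2), Bool.not_not]
        at h1
      obtain ⟨M₁, W₁, hr, hW, -⟩ := hc.confluent _ _ _ _ rfl (.of_one rfl (by simp))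
      generalize hp : ((.inr (v, k + 2), 1) : Strand n V) = p at hr
      generalize hq : ((.inr (u, j + 2), 0) : Strand n V) = q at hr
      cases hr with
      | cap d e a b ha hb h =>
        obtain ⟨rfl, rfl⟩ := Prod.mk.inj hp
        obtain ⟨rfl, rfl⟩ := Prod.mk.inj hq
        simp at hb
      | tri d e z i a b s hs hd he =>
        obtain ⟨rfl, rfl⟩ := Prod.mk.inj hp
        obtain ⟨rfl, rfl⟩ := Prod.mk.inj hq
        refine hD.2 v w u z ?_ ?_ ⟨adj_of_mate hvw, adj_of_mate hwu, adj_of_mate he,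
          adj_of_mate (mate_eq_comm hd)⟩
        · rintro rfl; simp at hu
        · rintro rfl
          simp [hw] at hW
      | aitch d e z z' i i' a b s t hs hd he hz =>
        obtain ⟨rfl, rfl⟩ := Prod.mk.inj hp
        obtain ⟨rfl, rfl⟩ := Prod.mk.inj hq
        have h3 := col_eq_not hd
        have h4 := col_eq_not he
        have h5 := col_eq_not hz
        rw [D.col_inr z' _ i', D.col_inr z _ i] at h5
        simp_all
    rcases append_pair_eq hl with ⟨rfl, rfl, rfl, rfl⟩ | ⟨rfl, rfl, rfl⟩ | ⟨rfl, rfl, rfl⟩ |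
      ⟨N, rfl, rfl⟩ | ⟨N, rfl, rfl⟩
    · exact absurd rfl h.right_ne_one
    · exact absurd rfl h.right_ne_one
    -- The rule consumes the strand from `w` and its right neighbor. Unless it leaves a strand of
    -- state `0` next to `v`, which `key` forbids, the piece is redrawn with a Y or H at `e` and
    -- that neighbor, followed by a Y with states `1, 0, 1` at `v`.
    · generalize hp : ((.inr (w, l + 1), 1) : Strand n V) = p at h
      cases h with
      | cap d' e' a b ha hb h =>
        obtain ⟨rfl, rfl⟩ := Prod.mk.inj hp
        subst hb
        refine Completes.step' (L := L' ++ [(d, 1)]) (R := R)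
          (.tri e e' w l 1 (-1) 0 .one_neg he (mate_eq_comm h)) (by simp [hUvw])
          (Completes.step' (L := L') (R := R) (.tri d (.inr (w, l + 2)) v k 1 0 1 .one_zero hd hwv) ?_
            hc (by simp) ?_ rfl) (by simp) rfl (by simp)
        · simp [hUvw, hvw0]
        · ext; simp; tauto
      | tri d' e' u j a b s hs hd' he' =>
        obtain ⟨rfl, rfl⟩ := Prod.mk.inj hp
        rcases ruleY_iff.1 hs with ⟨-, rfl, rfl⟩ | ⟨h, -⟩ | ⟨-, rfl, rfl⟩
        · simp only [Finset.disjoint_singleton_right, Finset.mem_union, Finset.mem_insert,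
            Finset.mem_singleton] at hU0
          refine Completes.step' (L := L' ++ [(d, 1)]) (R := R)
            (.aitch e e' w u l (j + 1) 1 0 0 1 .one_zero he he' (by rw [fin3_add_one_two, hd'])) ?_
            (Completes.step' (L := L') (R := (.inr (u, j + 2), 1) :: R)
              (.tri d (.inr (w, l + 2)) v k 1 0 1 .one_zero hd hwv) ?_
              hc (by simp) ?_ rfl) (by simp [fin3_add_one_one]) rfl (by simp)
          · simp; tauto
          · simp; tauto
          · ext; simp; tauto
        · simp at h
        · refine (key u j R ({u} ∪ ({v, w} ∪ U)) (by simp) (by simp) ?_ hd' (by simpa using hc)).elim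
          simp at hU0 ⊢
          tauto
      | aitch d' e' u u' j j' a b s t hs hd' he' hu =>
        obtain ⟨rfl, rfl⟩ := Prod.mk.inj hp
        rcases ruleH_iff.1 hs with ⟨-, rfl, rfl, rfl⟩ | ⟨h, -⟩ | ⟨h, -⟩
        · refine (key u j ((.inr (u', j' + 1), 1) :: R) ({u, u'} ∪ ({v, w} ∪ U)) (by simp) (by simp) ?_ hd' (by simpa using hc)).elim
          simp at hU0 ⊢
          tauto
        all_goals simp at h
    · have h1 := ih (L ++ M ++ N) R' (W ∪ U) ?_ ?_ (by simp)
      · exact Completes.step' (L := L) (R := N ++ (d, 1) :: (e, 1) :: R') h hU.2 h1 (by simp) rfl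
          (by simp)
      · simp [hUvw, hU]
      · ext; simp
    · have h1 := ih L' (N ++ M ++ R) (W ∪ U) ?_ ?_ (by simp)
      · exact Completes.step' (L := L' ++ (d, 1) :: (e, 1) :: N) (R := R) h hU.2 h1 (by simp) rfl
          (by simp)
      · simp [hUvw, hU]
      · ext; simp

/-- An `H` drawn over two strands of state `-1` does not disturb the growth of a non-elliptic
web. -/
theorem Completes.aitch_neg_neg [Fintype V] {D : SL3Web n V} (hD : D.IsNonElliptic)
    {v w : V} {k l : Fin 3} {d e : HalfEdge n V} (hd : D.mate d = .inr (v, k))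
    (he : D.mate e = .inr (w, l)) (hvw : D.mate (.inr (v, k + 1)) = .inr (w, l + 2))
    {L R : List (Strand n V)} {U : Finset V} (hU : Disjoint U {v, w})
    (h : D.Completes (L ++ (.inr (v, k + 2), -1) :: (.inr (w, l + 1), -1) :: R) ({v, w} ∪ U)) :
    D.Completes (L ++ (d, -1) :: (e, -1) :: R) U := by
  have h1 : -(l + 1) = -l + 2 := by clear * -; revert l; decide
  have h2 : -(k + 2) = -k + 1 := by clear * -; revert k; decide
  have h3 : -(l + 2) = -l + 1 := by clear * -; revert l; decide
  have h4 : -(k + 1) = -k + 2 := by clear * -; revert k; decide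
  have h5 : D.mirror.mate (.inr (w, -l + 1)) = .inr (v, -k + 2) := by
    rw [← h3, ← flip_inr, mirror_mate_flip, mate_eq_comm hvw, flip_inr, h4]
  have := h.mirror.aitch_one_one hD.mirror (d := flip e) (e := flip d) (by simp [he]) (by simp [hd])
    h5 (flipRow R) (flipRow L) U (by rwa [Finset.pair_comm]) (by rw [Finset.pair_comm]) (by
      simp [flipStrand, ← h1, ← h2])
  simpa [mirror_mirror, flipStrand] using this.mirror

end SL3Web

namespace SL3Web

variable {n : ℕ} {V : Type*}

/-! ### Positions: the strands without their states -/

/-- The growth rules without states: the neighboring strands `d`, `e` are replaced by the list `M`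
of strands, and the set `W` of vertices is drawn. -/
inductive Peel [DecidableEq V] (D : SL3Web n V) :
    HalfEdge n V → HalfEdge n V → List (HalfEdge n V) → Finset V → Prop
  | cap (d e : HalfEdge n V) (h : D.mate d = e) : Peel D d e [] ∅
  | tri (d e : HalfEdge n V) (v : V) (k : Fin 3) (hd : D.mate d = .inr (v, k))
      (he : D.mate e = .inr (v, k + 1)) : Peel D d e [.inr (v, k + 2)] {v}
  | aitch (d e : HalfEdge n V) (v w : V) (k l : Fin 3) (hd : D.mate d = .inr (v, k))
      (he : D.mate e = .inr (w, l)) (hvw : D.mate (.inr (v, k + 1)) = .inr (w, l + 2)) :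
      Peel D d e [.inr (v, k + 2), .inr (w, l + 1)] {v, w}

/-- A row of strands crossed from left to right: `q` is the face to the right of a strand, and the
face to its left is that of its other half-edge. -/
def FaceChain {Φ : Type*} (D : SL3Web n V) (q : HalfEdge n V → Φ) :
    Φ → List (HalfEdge n V) → Φ → Prop
  | a, [], b => a = b
  | a, y :: l, b => a = q (D.mate y) ∧ FaceChain D q (q y) l b

theorem faceChain_append {Φ : Type*} {D : SL3Web n V} {q : HalfEdge n V → Φ}
    {L M : List (HalfEdge n V)} {a b : Φ} :
    D.FaceChain q a (L ++ M) b ↔ ∃ c, D.FaceChain q a L c ∧ D.FaceChain q c M b := by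
  induction L generalizing a with
  | nil => simp [FaceChain]
  | cons y L ih => simp [FaceChain, ih, and_assoc]

/-- Locates the point where a walk around a face comes back to the row: just after a strand that has
this face on its right, unless the face is the initial one. -/
theorem FaceChain.pred {Φ : Type*} {D : SL3Web n V} {q : HalfEdge n V → Φ}
    {l : List (HalfEdge n V)} {a b : Φ} (h : D.FaceChain q a l b) {y : HalfEdge n V} (hy : y ∈ l) :
    q (D.mate y) = a ∨ ∃ L x R, l = L ++ x :: y :: R ∧ q x = q (D.mate y) := by
  induction l generalizing a with
  | nil => simp at hy
  | cons z l ih =>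
    rcases List.mem_cons.1 hy with rfl | hy
    · exact .inl h.1.symm
    · rcases ih h.2 hy with h1 | ⟨L, x, R, rfl, hx⟩
      · obtain ⟨L, R, rfl⟩ := List.append_of_mem hy
        rcases L with _ | ⟨x, L⟩
        · exact .inr ⟨[], z, R, rfl, h1.symm⟩
        · have h2 := h.2.1
          obtain ⟨c, h3, h4⟩ := faceChain_append.1 h.2
          rcases List.eq_nil_or_concat (x :: L) with h5 | ⟨L', x', h5⟩
          · simp at h5
          · rw [h5] at h3 ⊢
            rw [List.concat_eq_append] at h3 ⊢
            obtain ⟨c', -, h6⟩ := faceChain_append.1 h3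
            exact .inr ⟨z :: L', x', R, by simp, h6.2.trans h4.1⟩
      · exact .inr ⟨z :: L, x, R, rfl, hx⟩

theorem FaceChain.last {Φ : Type*} {D : SL3Web n V} {q : HalfEdge n V → Φ}
    {l : List (HalfEdge n V)} {a b : Φ} (h : D.FaceChain q a l b) (hl : l ≠ []) :
    ∃ x ∈ l, q x = b := by
  rcases List.eq_nil_or_concat l with rfl | ⟨L, x, rfl⟩
  · exact absurd rfl hl
  · rw [List.concat_eq_append] at h
    obtain ⟨c, -, h⟩ := faceChain_append.1 h
    exact ⟨x, by simp, h.2⟩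

theorem faceChain_ofFn {Φ : Type*} {D : SL3Web n V} {q : HalfEdge n V → Φ} {m : ℕ}
    {f : Fin (m + 1) → HalfEdge n V} {a b : Φ} (h0 : a = q (D.mate (f 0)))
    (h : ∀ i : Fin m, q (f i.castSucc) = q (D.mate (f i.succ))) (hb : q (f (Fin.last m)) = b) :
    D.FaceChain q a (List.ofFn f) b := by
  induction m generalizing a with
  | zero => simpa [FaceChain] using ⟨h0, hb⟩
  | succ m ih =>
    rw [List.ofFn_succ]
    refine ⟨h0, ih ?_ (fun i => ?_) ?_⟩
    · simpa using h 0
    · simpa using h i.succ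
    · simpa using hb

/-! ### The undrawn part of the web -/

variable [Fintype V] [DecidableEq V]

/-- The half-edges of the part of the web that is not drawn yet. -/
def live (l : List (HalfEdge n V)) (U : Finset V) : Finset (HalfEdge n V) :=
  l.toFinset ∪ (Uᶜ ×ˢ Finset.univ).map Function.Embedding.inr

theorem mem_live {l : List (HalfEdge n V)} {U : Finset V} {x : HalfEdge n V} :
    x ∈ live l U ↔ x ∈ l ∨ ∃ v k, v ∉ U ∧ x = .inr (v, k) := by
  simp [live, eq_comm]

theorem inr_mem_live {l : List (HalfEdge n V)} {U : Finset V} {v : V} (hv : v ∉ U) (k : Fin 3) :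
    .inr (v, k) ∈ live l U := mem_live.2 (.inr ⟨v, k, hv, rfl⟩)

/-- The strands `l` are the upper half-edges of the edges that lead from the drawn part of the web,
with set `U` of internal vertices, to the rest of it. -/
structure Valid (D : SL3Web n V) (l : List (HalfEdge n V)) (U : Finset V) : Prop where
  nodup : l.Nodup
  drawn : ∀ v k, .inr (v, k) ∈ l → v ∈ U
  closed : ∀ x ∈ live l U, D.mate x ∈ live l U

theorem Valid.card_live {D : SL3Web n V} {l : List (HalfEdge n V)} {U : Finset V}
    (h : D.Valid l U) : (live l U).card = l.length + 3 * Uᶜ.card := by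
  rw [live, Finset.card_union_of_disjoint, List.toFinset_card_of_nodup h.nodup, Finset.card_map,
    Finset.card_product, Finset.card_univ, Fintype.card_fin, mul_comm]
  rw [Finset.disjoint_left]
  rintro x hx hx'
  simp only [Finset.mem_map, Finset.mem_product, Finset.mem_compl, Finset.mem_univ, and_true] at hx'
  obtain ⟨⟨v, k⟩, hv, rfl⟩ := hx'
  exact hv (h.drawn v k (by simpa using hx))

/-! ### Small faces -/

omit [Fintype V] [DecidableEq V] in
-- Otherwise the two consecutive sides of the face at `v` would form a double edge.
theorem IsNonElliptic.ne_of_mate {D : SL3Web n V} (hD : D.IsNonElliptic) {u v w : V}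
    {i j k : Fin 3} (h1 : D.mate (.inr (u, i + 1)) = .inr (v, j))
    (h2 : D.mate (.inr (v, j + 1)) = .inr (w, k)) : u ≠ w := by
  rintro rfl
  have := hD.1 (.inr (v, j)) (.inr (v, j + 1)) rfl (by rw [h2, mate_eq_comm h1]; rfl)
  simp at this

omit [Fintype V] [DecidableEq V] in
theorem ne_of_mate {D : SL3Web n V} {u v : V} {i j : Fin 3}
    (h1 : D.mate (.inr (u, i)) = .inr (v, j)) : u ≠ v := by
  rintro rfl
  have h2 := col_eq_not h1
  rw [D.col_inr u j i] at h2
  simp at h2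

variable {Φ : Type*} [DecidableEq Φ]

/-- A face not meeting the row of strands has degree at least six. -/
theorem six_le_card_face {D : SL3Web n V} (hD : D.IsNonElliptic) {q : HalfEdge n V → Φ}
    (hq : ∀ v k, q (.inr (v, k + 1)) = q (D.mate (.inr (v, k)))) {l : List (HalfEdge n V)}
    {U : Finset V} (hv : D.Valid l U) {f : Φ} (h1 : ∀ x ∈ l, q x ≠ f)
    (h2 : ∀ x ∈ l, q (D.mate x) ≠ f) (hf : f ∈ (live l U).image q) :
    6 ≤ ((live l U).filter (q · = f)).card := by
  have next : ∀ v k, v ∉ U → q (.inr (v, k + 1)) = f → ∃ w j, w ∉ U ∧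
      D.mate (.inr (v, k + 1)) = .inr (w, j) ∧ q (.inr (w, j + 1)) = f := by
    intro v k hvU hvf
    rcases mem_live.1 (hv.closed _ (inr_mem_live hvU (k + 1))) with h | ⟨w, j, hw, h⟩
    · exact absurd (by rw [D.mate_mate, hvf]) (h2 _ h)
    · exact ⟨w, j, hw, h, by rw [hq, mate_eq_comm h, hvf]⟩
  obtain ⟨x, hx, hxf⟩ := Finset.mem_image.1 hf
  rcases mem_live.1 hx with h | ⟨v₀, k, hv₀, rfl⟩
  · exact absurd hxf (h1 _ h)
  obtain ⟨k₀, rfl⟩ : ∃ k₀, k = k₀ + 1 := ⟨k + 2, (fin3_add_two_one k).symm⟩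
  -- Six consecutive vertices along the face are distinct: at odd distance by the bipartition, at
  -- distance two because there are no double edges, at distance four because there are no 4-cycles.
  obtain ⟨v₁, k₁, hv₁, m₀, f₁⟩ := next v₀ k₀ hv₀ hxf
  obtain ⟨v₂, k₂, hv₂, m₁, f₂⟩ := next v₁ k₁ hv₁ f₁
  obtain ⟨v₃, k₃, hv₃, m₂, f₃⟩ := next v₂ k₂ hv₂ f₂
  obtain ⟨v₄, k₄, hv₄, m₃, f₄⟩ := next v₃ k₃ hv₃ f₃
  obtain ⟨v₅, k₅, hv₅, m₄, f₅⟩ := next v₄ k₄ hv₄ f₄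
  have a₀ := D.col_mate (.inr (v₀, k₀ + 1))
  have a₁ := D.col_mate (.inr (v₁, k₁ + 1))
  have a₂ := D.col_mate (.inr (v₂, k₂ + 1))
  have a₃ := D.col_mate (.inr (v₃, k₃ + 1))
  have a₄ := D.col_mate (.inr (v₄, k₄ + 1))
  rw [m₀] at a₀
  rw [m₁] at a₁
  rw [m₂] at a₂
  rw [m₃] at a₃
  rw [m₄] at a₄
  have e₀₁ := ne_of_mate m₀
  have e₁₂ := ne_of_mate m₁
  have e₂₃ := ne_of_mate m₂
  have e₃₄ := ne_of_mate m₃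
  have e₄₅ := ne_of_mate m₄
  have e₀₂ := hD.ne_of_mate m₀ m₁
  have e₁₃ := hD.ne_of_mate m₁ m₂
  have e₂₄ := hD.ne_of_mate m₂ m₃
  have e₃₅ := hD.ne_of_mate m₃ m₄
  have e₀₄ : v₀ ≠ v₄ := by
    rintro rfl
    exact hD.2 v₀ v₁ v₂ v₃ e₀₂ e₁₃ ⟨adj_of_mate m₀, adj_of_mate m₁, adj_of_mate m₂, adj_of_mate m₃⟩
  have e₁₅ : v₁ ≠ v₅ := by
    rintro rfl
    exact hD.2 v₁ v₂ v₃ v₄ e₁₃ e₂₄ ⟨adj_of_mate m₁, adj_of_mate m₂, adj_of_mate m₃, adj_of_mate m₄⟩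
  have e₀₃ : v₀ ≠ v₃ := by
    rintro rfl
    simp_all [col, HalfEdge.base]
  have e₁₄ : v₁ ≠ v₄ := by
    rintro rfl
    simp_all [col, HalfEdge.base]
  have e₂₅ : v₂ ≠ v₅ := by
    rintro rfl
    simp_all [col, HalfEdge.base]
  have e₀₅ : v₀ ≠ v₅ := by
    rintro rfl
    simp_all [col, HalfEdge.base]
  have hnd : [(v₀, k₀ + 1), (v₁, k₁ + 1), (v₂, k₂ + 1), (v₃, k₃ + 1), (v₄, k₄ + 1),
      (v₅, k₅ + 1)].Nodup := by
    simp [*]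
  have hnd' := hnd.map (Sum.inr_injective (α := Fin n))
  rw [show 6 = _ from (List.toFinset_card_of_nodup hnd').symm]
  refine Finset.card_le_card fun y hy => ?_
  simp only [List.map_cons, List.map_nil, List.mem_toFinset, List.mem_cons, List.not_mem_nil,
    or_false] at hy
  rw [Finset.mem_filter]
  rcases hy with rfl | rfl | rfl | rfl | rfl | rfl <;>
    exact ⟨inr_mem_live (by assumption) _, by assumption⟩

/-- A face to the right of exactly one strand, and not at the ends of the row, has degree at least
four unless a growth rule applies. -/
theorem peel_or_four_le_card_face {D : SL3Web n V} {q : HalfEdge n V → Φ}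
    (hq : ∀ v k, q (.inr (v, k + 1)) = q (D.mate (.inr (v, k)))) {l : List (HalfEdge n V)}
    {U : Finset V} (hv : D.Valid l U) {ω : Φ} (hc : D.FaceChain q ω l ω) {d : HalfEdge n V}
    (hd : d ∈ l) (hω : q d ≠ ω) (huniq : ∀ x ∈ l, q x = q d → x = d) :
    (∃ L e R M W, l = L ++ d :: e :: R ∧ D.Peel d e M W ∧ Disjoint U W) ∨
      4 ≤ ((live l U).filter (q · = q d)).card := by
  -- As `d` is the only strand with this face on its right, a walk around the face can return to the
  -- row only along the successor of `d`.
  have next : ∀ x ∈ live l U, q x = q d → (∃ L R, l = L ++ d :: D.mate x :: R) ∨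
      ∃ w j, w ∉ U ∧ D.mate x = .inr (w, j) ∧ q (.inr (w, j + 1)) = q d := by
    intro x hx hxd
    rcases mem_live.1 (hv.closed _ hx) with h | ⟨w, j, hw, h⟩
    · left
      rcases hc.pred h with h1 | ⟨L, y, R, h1, h2⟩
      · rw [D.mate_mate, hxd] at h1
        exact absurd h1 hω
      · rw [D.mate_mate, hxd] at h2
        rw [huniq y (by simp [h1]) h2] at h1
        exact ⟨L, R, h1⟩
    · right
      exact ⟨w, j, hw, h, by rw [hq, mate_eq_comm h, hxd]⟩
  have hdl : d ∈ live l U := mem_live.2 (.inl hd)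
  have hdne : ∀ v k, v ∉ U → d ≠ .inr (v, k) := by
    rintro v k hvU rfl
    exact hvU (hv.drawn _ _ hd)
  -- A return after one, two or three edges gives a cap, a Y or an H.
  rcases next d hdl rfl with ⟨L, R, h⟩ | ⟨v, k, hvU, hdv, f₁⟩
  · exact .inl ⟨L, _, R, _, _, h, .cap d _ rfl, by simp⟩
  rcases next _ (inr_mem_live hvU _) f₁ with ⟨L, R, h⟩ | ⟨w, j, hwU, hvw, f₂⟩
  · exact .inl ⟨L, _, R, _, _, h, .tri d _ v k hdv (D.mate_mate _), by simpa using hvU⟩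
  rcases next _ (inr_mem_live hwU _) f₂ with ⟨L, R, h⟩ | ⟨u, i, huU, hwu, f₃⟩
  · exact .inl ⟨L, _, R, _, _, h, .aitch d _ v w k (j + 1) hdv (D.mate_mate _)
      (by rw [fin3_add_one_two, hvw]), by simp [hvU, hwU]⟩
  right
  have hnd : [d, .inr (v, k + 1), .inr (w, j + 1), .inr (u, i + 1)].Nodup := by
    have hvu : .inr (v, k + 1) ≠ (.inr (u, i + 1) : HalfEdge n V) := by
      intro h
      simp only [Sum.inr.injEq, Prod.mk.injEq, add_left_inj] at h
      rw [← h.1, ← h.2, ← hdv] at hwu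
      exact hdne _ _ hwU (D.mate_injective hwu).symm
    have h1 := ne_of_mate hvw
    have h2 := ne_of_mate hwu
    have h3 := hdne v (k + 1) hvU
    have h4 := hdne w (j + 1) hwU
    have h5 := hdne u (i + 1) huU
    simp only [List.nodup_cons, List.mem_cons, List.not_mem_nil, or_false, not_or]
    simp [h1, h2, h3, h4, h5]
    simpa using hvu
  rw [show 4 = _ from (List.toFinset_card_of_nodup hnd).symm]
  refine Finset.card_le_card fun y hy => ?_
  simp only [List.mem_toFinset, List.mem_cons, List.not_mem_nil, or_false] at hy
  rw [Finset.mem_filter]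
  rcases hy with rfl | rfl | rfl | rfl
  · exact ⟨hdl, rfl⟩
  all_goals exact ⟨inr_mem_live (by assumption) _, by assumption⟩

/-- A discharging argument. If no rule applied, each face other than `ω` would satisfy: degree plus
twice the number of strands having it on their right is at least `6`; for `ω` this holds after
adding `5`. Summing over the `F` faces gives `6F ≤ 3(#l + #Uᶜ) + 5`, while `hF` gives `6F ≥ 3(#l +
#Uᶜ) + 6`. -/
theorem exists_peel {D : SL3Web n V} (hD : D.IsNonElliptic) {q : HalfEdge n V → Φ}
    (hq : ∀ v k, q (.inr (v, k + 1)) = q (D.mate (.inr (v, k)))) {l : List (HalfEdge n V)}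
    {U : Finset V} (hv : D.Valid l U) {ω : Φ} (hc : D.FaceChain q ω l ω)
    (hF : l.length + Uᶜ.card + 2 ≤ 2 * ((live l U).image q).card) :
    ∃ L d e R M W, l = L ++ d :: e :: R ∧ D.Peel d e M W ∧ Disjoint U W := by
  by_contra hno
  have key : ∀ f ∈ (live l U).image q, 6 ≤ ((live l U).filter (q · = f)).card +
      2 * (l.toFinset.filter (q · = f)).card + if f = ω then 5 else 0 := by
    intro f hf
    split_ifs with hfω
    · obtain ⟨x, hx, hxf⟩ := Finset.mem_image.1 hf
      have : 0 < ((live l U).filter (q · = f)).card :=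
        Finset.card_pos.2 ⟨x, Finset.mem_filter.2 ⟨hx, hxf⟩⟩
      omega
    · have hsub : (l.toFinset.filter (q · = f)).card ≤ ((live l U).filter (q · = f)).card :=
        Finset.card_le_card (Finset.filter_subset_filter _ Finset.subset_union_left)
      -- Two strands give degree at least `2` and a bonus of `4`. With one strand, degree `4` is
      -- needed; with none, degree `6`.
      rcases Nat.lt_or_ge 1 (l.toFinset.filter (q · = f)).card with h | h
      · omega
      rcases Nat.le_one_iff_eq_zero_or_eq_one.1 h with h | h
      · have h1 : ∀ x ∈ l, q x ≠ f := by
          intro x hx hxf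
          have : x ∈ l.toFinset.filter (q · = f) := by simp [hx, hxf]
          simp [Finset.card_eq_zero.1 h] at this
        have := six_le_card_face hD hq hv h1 (fun y hy hyf => ?_) hf
        · omega
        · rcases hc.pred hy with h2 | ⟨L, x, R, rfl, h2⟩
          · exact hfω (hyf.symm.trans h2)
          · exact h1 x (by simp) (h2.trans hyf)
      · obtain ⟨d, hd⟩ := Finset.card_eq_one.1 h
        have hd1 : d ∈ l.toFinset.filter (q · = f) := by simp [hd]
        simp only [Finset.mem_filter, List.mem_toFinset] at hd1
        obtain ⟨hd1, rfl⟩ := hd1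
        have huniq : ∀ x ∈ l, q x = q d → x = d := by
          intro x hx hxd
          have : x ∈ l.toFinset.filter (q · = q d) := by simp [hx, hxd]
          simpa [hd] using this
        rcases peel_or_four_le_card_face hq hv hc hd1 hfω huniq with ⟨L, e, R, M, W, h1⟩ | h1
        · exact absurd ⟨L, d, e, R, M, W, h1⟩ hno
        · omega
  have h1 := Finset.sum_le_sum key
  rw [Finset.sum_add_distrib, Finset.sum_add_distrib, ← Finset.mul_sum,
    ← Finset.card_eq_sum_card_image, ← Finset.card_eq_sum_card_fiberwise, hv.card_live,
    List.toFinset_card_of_nodup hv.nodup, Finset.sum_const, Finset.sum_ite_eq'] at h1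
  · have : (if ω ∈ (live l U).image q then 5 else 0) ≤ 5 := by split_ifs <;> omega
    simp only [smul_eq_mul] at h1
    omega
  · intro x hx
    exact Finset.mem_coe.2 (Finset.mem_image_of_mem q (Finset.subset_union_left hx))

/-- With no dangling strands, every face of the undrawn part has degree at least six, and there are
`3 * #Uᶜ` half-edges. Combined with Euler's formula, this excludes such parts. -/
theorem card_faces_le_of_closed {D : SL3Web n V} (hD : D.IsNonElliptic) {q : HalfEdge n V → Φ}
    (hq : ∀ v k, q (.inr (v, k + 1)) = q (D.mate (.inr (v, k)))) {U : Finset V}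
    (hv : D.Valid [] U) : 2 * ((live (n := n) [] U).image q).card ≤ Uᶜ.card := by
  have h1 := Finset.sum_le_sum fun f (hf : f ∈ (live (n := n) [] U).image q) =>
    six_le_card_face hD hq hv (f := f) (by simp) (by simp) hf
  rw [← Finset.card_eq_sum_card_image, hv.card_live, Finset.sum_const] at h1
  simp only [smul_eq_mul, List.length_nil] at h1
  omega

end SL3Web

namespace SL3Web

variable {n : ℕ} {V : Type*} [Fintype V] [DecidableEq V]

/-! ### Invariants of the growth rules -/

theorem Valid.ne_inr {D : SL3Web n V} {l : List (HalfEdge n V)} {U : Finset V}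
    (hv : D.Valid l U) {v : V} (hvU : v ∉ U) (k : Fin 3) {x : HalfEdge n V} (hx : x ∈ l) :
    x ≠ .inr (v, k) := by
  rintro rfl
  exact hvU (hv.drawn v k hx)

/-- The half-edges that a growth rule removes from the live part. -/
theorem Peel.exists_removed {D : SL3Web n V} {L R : List (HalfEdge n V)} {d e : HalfEdge n V}
    {M : List (HalfEdge n V)} {W U : Finset V} (h : D.Peel d e M W) (hU : Disjoint U W)
    (hv : D.Valid (L ++ d :: e :: R) U) :
    ∃ G : Finset (HalfEdge n V), (∀ x ∈ G, D.mate x ∈ G) ∧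
      live (L ++ M ++ R) (W ∪ U) = live (L ++ d :: e :: R) U \ G ∧
      (L ++ M ++ R).Nodup := by
  have hnd := hv.nodup
  simp only [List.nodup_append, List.nodup_cons, List.mem_cons, not_or, forall_eq_or_imp] at hnd
  obtain ⟨hL, ⟨⟨hde, hdR⟩, heR, hR⟩, hLR⟩ := hnd
  have hdL : d ∉ L := fun h => (hLR d h).1 rfl
  have heL : e ∉ L := fun h => (hLR e h).2.1 rfl
  have hnR : ∀ a ∈ L, a ∉ R := fun a ha haR => (hLR a ha).2.2 a haR rfl
  have hdU : ∀ v ∉ U, ∀ k, d ≠ .inr (v, k) := fun v hvU k => hv.ne_inr hvU k (by simp)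
  have heU : ∀ v ∉ U, ∀ k, e ≠ .inr (v, k) := fun v hvU k => hv.ne_inr hvU k (by simp)
  have hLU : ∀ v ∉ U, ∀ k, .inr (v, k) ∉ L := fun v hvU k h => hv.ne_inr hvU k (by simp [h]) rfl
  have hRU : ∀ v ∉ U, ∀ k, .inr (v, k) ∉ R := fun v hvU k h => hv.ne_inr hvU k (by simp [h]) rfl
  have hother : ∀ x, (x ∈ L ∨ x ∈ R) ↔ x ∈ L ++ d :: e :: R ∧ x ≠ d ∧ x ≠ e := by
    intro x
    by_cases h1 : x = d
    · simp [h1, hdL, hdR]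
    by_cases h2 : x = e
    · simp [h2, heL, heR]
    simp [h1, h2]
  cases h with
  | cap h =>
    refine ⟨{d, e}, by simp [h, mate_eq_comm h], ?_, ?_⟩
    · ext x
      have := hother x
      rw [Finset.mem_sdiff, mem_live, mem_live, List.append_nil, List.mem_append, this]
      simp only [Finset.empty_union, Finset.mem_insert, Finset.mem_singleton, not_or]
      constructor
      · rintro (h1 | ⟨v, k, hvU, rfl⟩)
        · exact ⟨.inl h1.1, h1.2⟩
        · exact ⟨.inr ⟨v, k, hvU, rfl⟩, (hdU v hvU k).symm, (heU v hvU k).symm⟩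
      · tauto
    · rw [List.append_nil, List.nodup_append]
      exact ⟨hL, hR, fun a ha b hb => (hLR a ha).2.2 b hb⟩
  | tri v k hd he =>
    simp only [Finset.disjoint_singleton_right] at hU
    refine ⟨{d, e, .inr (v, k), .inr (v, k + 1)}, ?_, ?_, ?_⟩
    · simp [hd, he, mate_eq_comm hd, mate_eq_comm he]
    · have h4 := fin3_ne_add_two k
      have h5 := fin3_add_one_ne_add_two k
      ext x
      have hx := hother x
      rw [Finset.mem_sdiff, mem_live, mem_live]
      rcases x with i | ⟨u, j⟩
      · simp at hx ⊢
        tauto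
      · by_cases huv : u = v
        · subst huv
          rcases fin3_cases k j with rfl | rfl | rfl <;>
            simp [(hdU u hU _).symm, (heU u hU _).symm, hLU u hU, hRU u hU, hU,
              h4, h5, h4.symm, h5.symm]
        · by_cases huU : u ∈ U
          · simp [huv, huU] at hx ⊢
            tauto
          · simp [huv, huU, (hdU u huU _).symm, (heU u huU _).symm]
    · simp only [List.nodup_append, List.mem_append, List.mem_singleton]
      refine ⟨⟨hL, by simp, ?_⟩, hR, ?_⟩
      · rintro a ha _ rfl rfl
        exact hLU v hU _ ha
      · rintro a (ha | rfl) b hb rfl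
        · exact hnR _ ha hb
        · exact hRU v hU _ hb
  | aitch v w k l hd he hvw =>
    simp only [Finset.disjoint_insert_right, Finset.disjoint_singleton_right] at hU
    obtain ⟨hvU, hwU⟩ := hU
    have hne := ne_of_mate hvw
    refine ⟨{d, e, .inr (v, k), .inr (w, l), .inr (v, k + 1), .inr (w, l + 2)}, ?_, ?_, ?_⟩
    · simp [hd, he, hvw, mate_eq_comm hd, mate_eq_comm he, mate_eq_comm hvw]
    · have h4 := fin3_ne_add_two k
      have h5 := fin3_add_one_ne_add_two k
      have h7 := fin3_ne_add_one l
      have h8 := fin3_add_one_ne_add_two l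
      ext x
      have hx := hother x
      rw [Finset.mem_sdiff, mem_live, mem_live]
      rcases x with i | ⟨u, j⟩
      · simp at hx ⊢
        tauto
      · by_cases huv : u = v
        · subst huv
          rcases fin3_cases k j with rfl | rfl | rfl <;>
            simp [(hdU u hvU _).symm, (heU u hvU _).symm, hLU u hvU, hRU u hvU,
              hvU, h4.symm, h5.symm, hne]
        by_cases huw : u = w
        · subst huw
          rcases fin3_cases l j with rfl | rfl | rfl <;>
            simp [(hdU u hwU _).symm, (heU u hwU _).symm, hLU u hwU, hRU u hwU,
              hwU, h7, h8, h7.symm, h8.symm, hne.symm]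
        · by_cases huU : u ∈ U
          · simp [huv, huw, huU] at hx ⊢
            tauto
          · simp [huv, huw, huU, (hdU u huU _).symm, (heU u huU _).symm]
    · simp only [List.nodup_append, List.mem_append, List.mem_cons, List.not_mem_nil, or_false]
      refine ⟨⟨hL, by simp [hne], ?_⟩, hR, ?_⟩
      · rintro a ha _ (rfl | rfl) rfl
        · exact hLU v hvU _ ha
        · exact hLU w hwU _ ha
      · rintro a (ha | rfl | rfl) b hb rfl
        · exact hnR _ ha hb
        · exact hRU v hvU _ hb
        · exact hRU w hwU _ hb

/-- The removed half-edges make up whole edges, so the rest stays closed under `mate`. -/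
theorem Peel.valid {D : SL3Web n V} {L R : List (HalfEdge n V)} {d e : HalfEdge n V}
    {M : List (HalfEdge n V)} {W U : Finset V} (h : D.Peel d e M W) (hU : Disjoint U W)
    (hv : D.Valid (L ++ d :: e :: R) U) : D.Valid (L ++ M ++ R) (W ∪ U) := by
  obtain ⟨G, h1, h2, h3⟩ := h.exists_removed hU hv
  refine ⟨h3, ?_, ?_⟩
  · intro v k hvk
    have hdr := hv.drawn v k
    cases h <;> simp at hvk hdr ⊢ <;> tauto
  · intro x hx
    rw [h2, Finset.mem_sdiff] at hx ⊢
    refine ⟨hv.closed x hx.1, fun hG => hx.2 ?_⟩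
    simpa [D.mate_mate] using h1 _ hG

variable {Φ : Type*} [DecidableEq Φ]

omit [Fintype V] [DecidableEq Φ] in
-- The faces on the two outer sides of the piece are unchanged. Only the face between `d` and `e`
-- leaves the chain; for an H, the face below the horizontal edge replaces it.
theorem Peel.faceChain {D : SL3Web n V} {q : HalfEdge n V → Φ}
    (hq : ∀ v k, q (.inr (v, k + 1)) = q (D.mate (.inr (v, k)))) {L R : List (HalfEdge n V)}
    {d e : HalfEdge n V} {M : List (HalfEdge n V)} {W : Finset V} {a b : Φ} (h : D.Peel d e M W)
    (hc : D.FaceChain q a (L ++ d :: e :: R) b) : D.FaceChain q a (L ++ M ++ R) b := by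
  obtain ⟨c, h1, h2, h3, h4⟩ := faceChain_append.1 hc
  rw [List.append_assoc]
  refine faceChain_append.2 ⟨c, h1, ?_⟩
  cases h with
  | cap h =>
    rw [h] at h2
    rw [h2]
    exact h4
  | tri v k hd he =>
    refine ⟨?_, ?_⟩
    · rw [h2, hd, ← hq, fin3_add_two_one]
    · rw [show q (.inr (v, k + 2)) = q e by
        rw [← fin3_add_one_one, hq, mate_eq_comm he]]
      exact h4
  | aitch v w k l hd he hvw =>
    refine ⟨?_, ?_, ?_⟩
    · rw [h2, hd, ← hq, fin3_add_two_one]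
    · rw [← fin3_add_one_one, hq, hvw, ← hq, fin3_add_one_one]
    · rw [show q (.inr (w, l + 1)) = q e by
        rw [hq, mate_eq_comm he]]
      exact h4

/-- A growth rule removes one face, unless it ends the row of strands. -/
theorem Peel.card_faces {D : SL3Web n V} {q : HalfEdge n V → Φ}
    (hq : ∀ v k, q (.inr (v, k + 1)) = q (D.mate (.inr (v, k)))) {L R : List (HalfEdge n V)}
    {d e : HalfEdge n V} {M : List (HalfEdge n V)} {W U : Finset V} {ω : Φ} (h : D.Peel d e M W)
    (hU : Disjoint U W) (hv : D.Valid (L ++ d :: e :: R) U)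
    (hc : D.FaceChain q ω (L ++ d :: e :: R) ω) (hne : L ++ M ++ R ≠ []) :
    ((live (L ++ d :: e :: R) U).image q).card ≤
      ((live (L ++ M ++ R) (W ∪ U)).image q).card + 1 := by
  have hv' := h.valid hU hv
  have hc' := h.faceChain hq hc
  -- Only the face to the right of `d` can be lost: every other removed half-edge shares its face
  -- with a remaining strand or with the mate of one.
  suffices hs : (live (L ++ d :: e :: R) U).image q ⊆
      insert (q d) ((live (L ++ M ++ R) (W ∪ U)).image q) from
    (Finset.card_le_card hs).trans (Finset.card_insert_le _ _)
  intro f hf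
  obtain ⟨x, hx, rfl⟩ := Finset.mem_image.1 hf
  rw [Finset.mem_insert]
  have hmem : ∀ y ∈ L ++ M ++ R, q y ∈ (live (L ++ M ++ R) (W ∪ U)).image q := fun y hy =>
    Finset.mem_image_of_mem q (mem_live.2 (.inl hy))
  have hmate : ∀ y ∈ L ++ M ++ R, q (D.mate y) ∈ (live (L ++ M ++ R) (W ∪ U)).image q := fun y hy =>
    Finset.mem_image_of_mem q (hv'.closed _ (mem_live.2 (.inl hy)))
  by_cases hx' : x ∈ live (L ++ M ++ R) (W ∪ U)
  · exact .inr (Finset.mem_image_of_mem q hx')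
  rw [mem_live] at hx hx'
  by_cases hxd : x = d
  · exact .inl (by rw [hxd])
  cases h with
  | cap h =>
    obtain rfl : x = e := by
      simp at hx hx'
      tauto
    right
    obtain ⟨c, h1, h2, h3, h4⟩ := faceChain_append.1 hc
    -- The face to the right of a cap is the face to the left of the next strand or, when the cap is
    -- last in the row, the face `ω` to the left of the first strand. So some strand must remain.
    rcases R with _ | ⟨g, R⟩
    · rcases L with _ | ⟨g, L⟩
      · simp at hne
      · rw [show q x = q (D.mate g) from Eq.trans h4 h1.1]
        exact hmate g (by simp)
    · rw [show q x = q (D.mate g) from h4.1]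
      exact hmate g (by simp)
  | tri v k hd he =>
    have hxx : x = e ∨ x = .inr (v, k) ∨ x = .inr (v, k + 1) := by
      simp only [not_or, not_exists, not_and] at hx'
      rcases hx with hx | ⟨u, j, huU, rfl⟩
      · left
        simp at hx hx'
        tauto
      · right
        by_cases huv : u = v
        · subst huv
          rcases fin3_cases k j with rfl | rfl | rfl
          · exact .inl rfl
          · exact .inr rfl
          · simp at hx'
        · exact (hx'.2 u j (by simp [huv, huU]) rfl).elim
    have e1 : q (.inr (v, k + 2)) = q e := by rw [← fin3_add_one_one, hq, mate_eq_comm he]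
    have e2 : q (.inr (v, k)) = q (D.mate (.inr (v, k + 2))) := by rw [← hq, fin3_add_two_one]
    rcases hxx with rfl | rfl | rfl
    · exact .inr (e1 ▸ hmem _ (by simp))
    · exact .inr (e2 ▸ hmate _ (by simp))
    · exact .inl (by rw [hq, mate_eq_comm hd])
  | aitch v w k l hd he hvw =>
    have hxx : x = e ∨ x = .inr (v, k) ∨ x = .inr (v, k + 1) ∨ x = .inr (w, l) ∨
        x = .inr (w, l + 2) := by
      simp only [not_or, not_exists, not_and] at hx'
      rcases hx with hx | ⟨u, j, huU, rfl⟩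
      · left
        simp at hx hx'
        tauto
      · right
        by_cases huv : u = v
        · subst huv
          rcases fin3_cases k j with rfl | rfl | rfl
          · exact .inl rfl
          · exact .inr (.inl rfl)
          · simp at hx'
        by_cases huw : u = w
        · subst huw
          rcases fin3_cases l j with rfl | rfl | rfl
          · exact .inr (.inr (.inl rfl))
          · simp at hx'
          · exact .inr (.inr (.inr rfl))
        · exact (hx'.2 u j (by simp [huv, huw, huU]) rfl).elim
    have e1 : q (.inr (w, l + 1)) = q e := by rw [hq, mate_eq_comm he]
    have e2 : q (.inr (v, k)) = q (D.mate (.inr (v, k + 2))) := by rw [← hq, fin3_add_two_one]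
    have e3 : q (.inr (w, l + 2)) = q (D.mate (.inr (w, l + 1))) := by
      rw [← hq, fin3_add_one_one]
    have e4 : q (.inr (v, k + 1)) = q d := by rw [hq, mate_eq_comm hd]
    rcases hxx with rfl | rfl | rfl | rfl | rfl
    · exact .inr (e1 ▸ hmem _ (by simp))
    · exact .inr (e2 ▸ hmate _ (by simp))
    · exact .inl e4
    · refine .inl (Eq.trans ?_ e4)
      rw [← mate_eq_comm hvw, ← hq, fin3_add_two_one]
    · exact .inr (e3 ▸ hmate _ (by simp))

/-! ### Existence of a labeling -/

/-- A labeling of a row of strands extends over a growth rule of a non-elliptic web. -/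
theorem Peel.exists_completes {D : SL3Web n V} (hD : D.IsNonElliptic) {L R : List (HalfEdge n V)}
    {d e : HalfEdge n V} {M : List (HalfEdge n V)} {W U : Finset V} (h : D.Peel d e M W)
    (hU : Disjoint U W)
    (hs : ∃ s : List (Strand n V), s.map Prod.fst = L ++ M ++ R ∧ D.Completes s (W ∪ U)) :
    ∃ s : List (Strand n V), s.map Prod.fst = L ++ d :: e :: R ∧ D.Completes s U := by
  obtain ⟨s, hs, hc⟩ := hs
  obtain ⟨s', sR, rfl, hs', rfl⟩ := List.map_eq_append_iff.1 hs
  obtain ⟨sL, sM, rfl, rfl, rfl⟩ := List.map_eq_append_iff.1 hs'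
  suffices hsuff : ∃ a b, D.Completes (sL ++ (d, a) :: (e, b) :: sR) U by
    obtain ⟨a, b, h⟩ := hsuff
    exact ⟨_, by simp, h⟩
  generalize hM : sM.map Prod.fst = M at h
  cases h with
  | cap h =>
    obtain rfl := List.map_eq_nil_iff.1 hM
    exact ⟨1, -1, .step _ _ _ _ _ _ _ (.cap d e 1 (-1) rfl rfl h) hU hc⟩
  | tri v k hd he =>
    obtain ⟨⟨x, s⟩, rfl, hx⟩ := List.map_eq_singleton_iff.1 hM
    dsimp only at hx
    subst hx
    obtain ⟨a, b, hab⟩ : ∃ a b, RuleY a b s := by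
      cases s
      exacts [⟨_, _, .one_neg⟩, ⟨_, _, .zero_neg⟩, ⟨_, _, .one_zero⟩]
    exact ⟨a, b, .step _ _ _ _ _ _ _ (.tri d e v k a b s hab hd he) hU hc⟩
  | aitch v w k l hd he hvw =>
    obtain ⟨⟨x, s⟩, m, rfl, hx, hm⟩ := List.map_eq_cons_iff.1 hM
    obtain ⟨⟨y, t⟩, rfl, hy⟩ := List.map_eq_singleton_iff.1 hm
    dsimp only at hx hy
    subst hx hy
    -- By confluence a descent below the H would be removed by a rule. A cap would double the
    -- horizontal edge, an H would close a 4-cycle, and a Y is impossible because the signs differ.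
    by_cases hdesc : D.Descent ((.inr (v, k + 2), s) : Strand n V) (.inr (w, l + 1), t)
    · exfalso
      obtain ⟨M₁, W₁, hr, hW, -⟩ := hc.confluent sL _ _ sR (by simp) hdesc
      have hcol := col_eq_not hvw
      rw [D.col_inr w _ (l + 1), D.col_inr v _ (k + 2)] at hcol
      generalize hp : ((.inr (v, k + 2), s) : Strand n V) = p at hr
      generalize hq : ((.inr (w, l + 1), t) : Strand n V) = p' at hr
      cases hr with
      | cap d e a b ha hb h =>
        obtain ⟨rfl, rfl⟩ := Prod.mk.inj hp
        obtain ⟨rfl, rfl⟩ := Prod.mk.inj hq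
        have := hD.1 (.inr (v, k + 1)) (.inr (v, k + 2)) rfl (by rw [h, hvw]; rfl)
        simp at this
      | tri d e z i a b s hs hd he =>
        obtain ⟨rfl, rfl⟩ := Prod.mk.inj hp
        obtain ⟨rfl, rfl⟩ := Prod.mk.inj hq
        have h1 := col_eq_not hd
        have h2 := col_eq_not he
        rw [D.col_inr z _ i] at h2
        simp_all
      | aitch d e z z' i i' a b s t hs hd he hz =>
        obtain ⟨rfl, rfl⟩ := Prod.mk.inj hp
        obtain ⟨rfl, rfl⟩ := Prod.mk.inj hq
        simp only [Finset.disjoint_insert_right, Finset.disjoint_singleton_right,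
          Finset.mem_union, Finset.mem_insert, Finset.mem_singleton, not_or] at hW
        exact hD.2 v w z' z (Ne.symm hW.2.1.1) (Ne.symm hW.1.1.2)
          ⟨adj_of_mate hvw, adj_of_mate he, adj_of_mate (mate_eq_comm hz),
            adj_of_mate (mate_eq_comm hd)⟩
    · have hst : s ≠ 0 ∨ t ≠ 0 := by
        by_contra! hst
        refine hdesc (.inr ⟨hst.1, hst.2, ?_⟩)
        have hcol := col_eq_not hvw
        rw [D.col_inr w _ (l + 1), D.col_inr v _ (k + 2)] at hcol
        simp [hcol]
      have hst' : ¬ t < s := fun h => hdesc (.inl h)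
      -- Of the pairs that are not descents, three are the bottoms of the H rules. The other two,
      -- `1, 1` and `-1, -1`, belong to no rule and reappear unchanged on top.
      have hcases : s = 1 ∧ t = 1 ∨ s = -1 ∧ t = -1 ∨ ∃ a b, RuleH a b s t := by
        have := (by decide : ∀ s t : SignType, (s ≠ 0 ∨ t ≠ 0) → ¬ t < s →
          s = 1 ∧ t = 1 ∨ s = -1 ∧ t = -1 ∨ s = 0 ∧ t = 1 ∨ s = -1 ∧ t = 1 ∨ s = -1 ∧ t = 0)
          s t hst hst'
        rcases this with h | h | ⟨rfl, rfl⟩ | ⟨rfl, rfl⟩ | ⟨rfl, rfl⟩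
        · exact .inl h
        · exact .inr (.inl h)
        · exact .inr (.inr ⟨_, _, .one_zero⟩)
        · exact .inr (.inr ⟨_, _, .zero_zero⟩)
        · exact .inr (.inr ⟨_, _, .zero_neg⟩)
      rcases hcases with ⟨rfl, rfl⟩ | ⟨rfl, rfl⟩ | ⟨a, b, hab⟩
      · exact ⟨1, 1, hc.aitch_one_one hD hd he hvw sL sR U hU rfl (by simp)⟩
      · exact ⟨-1, -1, Completes.aitch_neg_neg hD hd he hvw hU (by simpa using hc)⟩
      · exact ⟨a, b, .step _ _ _ _ _ _ _ (.aitch d e v w k l a b s t hab hd he hvw) hU hc⟩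

/-- The change of `#strands + #undrawn vertices` under a growth rule. -/
theorem Peel.card_add {D : SL3Web n V} {d e : HalfEdge n V} {M : List (HalfEdge n V)}
    {W U : Finset V} (h : D.Peel d e M W) (hU : Disjoint U W) :
    M.length + (W ∪ U)ᶜ.card = Uᶜ.card ∧ (W ∪ U)ᶜ.card ≤ Uᶜ.card ∧
      (M = [] ∧ W = ∅ ∨ (W ∪ U)ᶜ.card < Uᶜ.card) := by
  have h1 : (W ∪ U)ᶜ.card + W.card = Uᶜ.card := by
    rw [← Finset.card_union_of_disjoint]
    · congr 1
      ext v
      have : v ∈ W → v ∉ U := fun hW hU' => Finset.disjoint_left.1 hU hU' hW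
      simp
      tauto
    · rw [Finset.disjoint_left]
      intro v
      simp
      tauto
  cases h with
  | cap => simp
  | tri => simp at h1 ⊢; omega
  | aitch v w k l hd he hvw =>
    rw [Finset.card_pair (ne_of_mate hvw)] at h1
    simp at h1 ⊢
    omega

/-- A non-elliptic web with enough faces has a labeling for which the growth algorithm produces
it. -/
theorem exists_completes {D : SL3Web n V} (hD : D.IsNonElliptic) {q : HalfEdge n V → Φ}
    (hq : ∀ v k, q (.inr (v, k + 1)) = q (D.mate (.inr (v, k)))) {ω : Φ} {K : ℕ} (hK : 2 ≤ K)
    (hfl : ∀ U : Finset V, D.Valid [] U → U ≠ Finset.univ → 3 ≤ K) {l : List (HalfEdge n V)}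
    {U : Finset V} (hv : D.Valid l U) (hc : D.FaceChain q ω l ω)
    (hF : l ≠ [] → l.length + Uᶜ.card + K ≤ 2 * ((live l U).image q).card)
    (hF' : l = [] → Uᶜ.card + K ≤ 2 * ((live l U).image q).card + 2) :
    ∃ s : List (Strand n V), s.map Prod.fst = l ∧ D.Completes s U := by
  induction hN : l.length + 2 * Uᶜ.card using Nat.strong_induction_on generalizing l U with
  | _ N ih =>
  -- A rule lowers `#l + #Uᶜ` by two and the number `F` of faces by at most one, which preserves the
  -- bound `hF`; a final cap can lose two faces, hence the `+ 2` in `hF'`. When no strand is left,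
  -- `2F ≤ #Uᶜ` gives `K ≤ 2`, so `hfl` leaves only the finished web.
  by_cases hl : l = []
  · subst hl
    have h1 := card_faces_le_of_closed hD hq hv
    have h2 := hF' rfl
    by_cases hU : U = Finset.univ
    · subst hU
      exact ⟨[], rfl, .done⟩
    · have := hfl U hv hU
      omega
  · have hF0 := hF hl
    obtain ⟨L, d, e, R, M, W, rfl, hp, hW⟩ := exists_peel hD hq hv hc (by omega)
    refine hp.exists_completes hD hW ?_
    have hcard := hp.card_add hW
    have hlen : (L ++ M ++ R).length + (W ∪ U)ᶜ.card + 2 =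
        (L ++ d :: e :: R).length + Uᶜ.card := by
      simp only [List.length_append, List.length_cons]
      omega
    refine ih _ ?_ (hp.valid hW hv) (hp.faceChain hq hc) (fun hne => ?_) (fun hnil => ?_) rfl
    · omega
    · have := hp.card_faces hq hW hv hc hne
      omega
    · cases hp with
      | cap h =>
        simp at hnil
        obtain ⟨rfl, rfl⟩ := hnil
        have : (live ([] ++ d :: e :: []) U).image q ⊆
            insert (q d) (insert (q e) ((live ([] ++ [] ++ []) (∅ ∪ U)).image q)) := by
          intro f
          simp only [Finset.mem_image, Finset.mem_insert, mem_live]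
          rintro ⟨x, hx, rfl⟩
          rcases hx with hx | hx
          · simp only [List.nil_append, List.mem_cons, List.not_mem_nil, or_false] at hx
            rcases hx with rfl | rfl
            · exact .inl rfl
            · exact .inr (.inl rfl)
          · exact .inr (.inr ⟨x, .inr (by simpa using hx), rfl⟩)
        have h1 := Finset.card_le_card this
        have h2 := Finset.card_insert_le (q d)
          (insert (q e) ((live ([] ++ [] ++ []) (∅ ∪ U)).image q))
        have h3 := Finset.card_insert_le (q e) ((live ([] ++ [] ++ []) (∅ ∪ U)).image q)
        simp at hF0 hlen h1 h2 h3 ⊢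
        omega
      | tri => simp at hnil
      | aitch => simp at hnil

end SL3Web

namespace SL3Web

variable {n : ℕ} {V : Type*}

/-! ### Euler's formula -/

theorem rotation_inr (v : V) (k : Fin 3) :
    rotation n V (.inr (v, k)) = .inr (v, k + 1) := by
  simp [rotation]

theorem rotation_inl_succ {m : ℕ} (i : Fin m) :
    rotation (m + 1) V (.inl i.succ) = .inl i.castSucc := by
  simp [rotation, sub_eq_iff_eq_add]

theorem rotation_inl_zero {m : ℕ} :
    rotation (m + 1) V (.inl 0) = .inl (Fin.last m) := by
  simp [rotation, neg_eq_iff_add_eq_zero, add_comm (1 : Fin (m + 1))]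

/-- The cycle of a half-edge under a permutation. -/
def cycleOf (f : Equiv.Perm (HalfEdge n V)) (x : HalfEdge n V) :
    Quotient (Equiv.Perm.SameCycle.setoid f) := Quotient.mk _ x

theorem cycleOf_apply (f : Equiv.Perm (HalfEdge n V)) (x : HalfEdge n V) :
    cycleOf f (f x) = cycleOf f x :=
  Quotient.sound (Equiv.Perm.sameCycle_apply_left.2 (Equiv.Perm.SameCycle.refl f x))

theorem cycleOf_surjective (f : Equiv.Perm (HalfEdge n V)) : Function.Surjective (cycleOf f) :=
  Quotient.mk_surjective

theorem cycleOf_rotation_inr (v : V) (k : Fin 3) :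
    cycleOf (rotation n V) (.inr (v, k)) = cycleOf (rotation n V) (.inr (v, 0)) := by
  have h : ∀ k, cycleOf (rotation n V) (.inr (v, k + 1)) = cycleOf (rotation n V) (.inr (v, k)) :=
    fun k => by rw [← rotation_inr, cycleOf_apply]
  rcases fin3_cases 0 k with rfl | rfl | rfl
  · rfl
  · exact h 0
  · exact (h 1).trans (h 0)

theorem cycleOf_rotation_inl {m : ℕ} (i : Fin (m + 1)) :
    cycleOf (rotation (m + 1) V) (.inl i) = cycleOf (rotation (m + 1) V) (.inl 0) := by
  induction i using Fin.induction with
  | zero => rfl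
  | succ i ih => rw [← ih, ← rotation_inl_succ, cycleOf_apply]

variable [Fintype V]

/-- All boundary half-edges lie in one cycle, that of the additional vertex on the sphere. -/
theorem cycleCount_rotation_succ_le {m : ℕ} :
    cycleCount (rotation (m + 1) V) ≤ Fintype.card V + 1 := by
  rw [← Fintype.card_option, ← Nat.card_eq_fintype_card]
  refine Nat.card_le_card_of_surjective
    (fun o : Option V => cycleOf _ (o.elim (.inl 0) fun v => .inr (v, 0))) fun c => ?_
  obtain ⟨x, rfl⟩ := cycleOf_surjective _ c
  rcases x with i | ⟨v, k⟩
  · exact ⟨none, (cycleOf_rotation_inl i).symm⟩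
  · exact ⟨some v, (cycleOf_rotation_inr v k).symm⟩

theorem cycleCount_rotation_zero_le : cycleCount (rotation 0 V) ≤ Fintype.card V := by
  rw [← Nat.card_eq_fintype_card]
  refine Nat.card_le_card_of_surjective (fun v : V => cycleOf _ (.inr (v, 0))) fun c => ?_
  obtain ⟨x, rfl⟩ := cycleOf_surjective _ c
  rcases x with i | ⟨v, k⟩
  · exact i.elim0
  · exact ⟨v, (cycleOf_rotation_inr v k).symm⟩

/-- Cycles of an involution have at most two elements. -/
theorem card_le_two_mul_cycleCount_matePerm (D : SL3Web n V) :
    n + 3 * Fintype.card V ≤ 2 * cycleCount D.matePerm := by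
  have h1 : Nat.card (HalfEdge n V) = n + 3 * Fintype.card V := by
    rw [Nat.card_eq_fintype_card]
    simp [mul_comm]
  have h2 : Nat.card (Bool × Quotient (Equiv.Perm.SameCycle.setoid D.matePerm)) =
      2 * cycleCount D.matePerm := by
    rw [Nat.card_prod]
    simp [cycleCount]
  rw [← h1, ← h2]
  refine Nat.card_le_card_of_surjective
    (fun p => if p.1 then p.2.out else D.mate p.2.out) fun x => ?_
  obtain ⟨i, hi⟩ : Equiv.Perm.SameCycle D.matePerm (cycleOf D.matePerm x).out x :=
    Quotient.exact (Quotient.out_eq (cycleOf D.matePerm x))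
  have hsq : D.matePerm ^ (2 : ℤ) = 1 := by
    ext y
    rw [zpow_two]
    exact D.mate_mate y
  rcases Int.even_or_odd' i with ⟨j, rfl | rfl⟩
  · rw [zpow_mul, hsq, one_zpow] at hi
    exact ⟨(true, cycleOf D.matePerm x), hi⟩
  · rw [zpow_add, zpow_mul, hsq, one_zpow, one_mul, zpow_one] at hi
    exact ⟨(false, cycleOf D.matePerm x), hi⟩

theorem componentCount_pos (D : SL3Web n V) [Nonempty (HalfEdge n V)] : 1 ≤ D.componentCount := by
  have : Nonempty (Quot fun d e : HalfEdge n V => e = rotation n V d ∨ e = D.mate d) :=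
    Nonempty.map (Quot.mk _) inferInstance
  exact Nat.card_pos

/-- A web with a part that is not connected to the boundary has at least two components. -/
theorem two_le_componentCount [DecidableEq V] {m : ℕ} {D : SL3Web (m + 1) V} {U : Finset V}
    (hv : D.Valid [] U) (hU : U ≠ Finset.univ) : 2 ≤ D.componentCount := by
  classical
  obtain ⟨v, hvU⟩ : ∃ v, v ∉ U := by
    by_contra! h
    exact hU (Finset.eq_univ_iff_forall.2 h)
  have hcl : ∀ x, D.mate x ∈ live [] U ↔ x ∈ live [] U := fun x =>
    ⟨fun h => by simpa [D.mate_mate] using hv.closed _ h, hv.closed x⟩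
  have hrot : ∀ x, rotation (m + 1) V x ∈ live [] U ↔ x ∈ live [] U := by
    rintro (i | ⟨w, k⟩)
    · simp [mem_live, rotation]
    · simp [mem_live, rotation_inr]
  have h2 : Nat.card Bool = 2 := by simp
  rw [← h2]
  refine Nat.card_le_card_of_surjective (Quot.lift (fun x => decide (x ∈ live [] U)) ?_) ?_
  · rintro x y (rfl | rfl)
    · simp [hrot]
    · simp [hcl]
  · rintro (_ | _)
    · exact ⟨Quot.mk _ (.inl 0), by simp [mem_live]⟩
    · exact ⟨Quot.mk _ (.inr (v, 0)), by simp [mem_live, hvU]⟩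

/-- The growth algorithm produces every non-elliptic web from some state string. -/
theorem IsPlanar.exists_completes_start [DecidableEq V] {D : SL3Web n V} (hplanar : D.IsPlanar)
    (hD : D.IsNonElliptic) : ∃ J : Fin n → SignType,
      D.Completes (List.ofFn fun i => ((.inl i : HalfEdge n V), J i)) ∅ := by
  classical
  let f := rotation n V * D.matePerm
  have hf : ∀ x, cycleOf f (rotation n V x) = cycleOf f (D.mate x) := fun x => by
    rw [← cycleOf_apply f (D.mate x)]
    simp [f, matePerm, D.mate_mate]
  have hq : ∀ v k, cycleOf f (.inr (v, k + 1)) = cycleOf f (D.mate (.inr (v, k))) := fun v k => by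
    rw [← hf, rotation_inr]
  have hlive : live (List.ofFn fun i : Fin n => (.inl i : HalfEdge n V)) ∅ = Finset.univ := by
    ext x
    rcases x with i | ⟨v, k⟩ <;> simp [mem_live, List.mem_ofFn]
  have hv : D.Valid (List.ofFn fun i : Fin n => (.inl i : HalfEdge n V)) ∅ := by
    refine ⟨List.nodup_ofFn.2 Sum.inl_injective, ?_, ?_⟩
    · simp [List.mem_ofFn]
    · simp [hlive]
  have hF : ((live (List.ofFn fun i : Fin n => (.inl i : HalfEdge n V)) ∅).image
      (cycleOf f)).card = cycleCount f := by
    rw [hlive, cycleCount, ← Set.ncard_univ, ← Set.ncard_coe_finset, Finset.coe_image,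
      Finset.coe_univ, Set.image_univ, (cycleOf_surjective f).range_eq]
  have hmate := D.card_le_two_mul_cycleCount_matePerm
  have hpl : cycleCount (rotation n V) + cycleCount f =
    cycleCount D.matePerm + 2 * D.componentCount := hplanar
  suffices h : ∃ s : List (Strand n V), s.map Prod.fst = List.ofFn (fun i : Fin n => .inl i) ∧
      D.Completes s ∅ by
    obtain ⟨s, hs, hc⟩ := h
    have hlen : s.length = n := by simpa using congrArg List.length hs
    refine ⟨fun i => (s[i]'(by omega)).2, ?_⟩
    convert hc
    refine List.ext_getElem (by simp [hlen]) fun i h1 h2 => ?_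
    have : (s.map Prod.fst)[i]'(by simpa using h2) =
      (List.ofFn fun i : Fin n => (.inl i : HalfEdge n V))[i]'(by simpa using h1) := by
      simp only [hs]
    simp only [List.getElem_map, List.getElem_ofFn] at this ⊢
    exact Prod.ext this.symm rfl
  cases n with
  | zero =>
    rcases isEmpty_or_nonempty V with hV | ⟨⟨v⟩⟩
    · refine ⟨[], by simp, ?_⟩
      rw [show (∅ : Finset V) = Finset.univ from Subsingleton.elim _ _]
      exact .done
    · have : Nonempty (HalfEdge 0 V) := ⟨.inr (v, 0)⟩
      have hC := D.componentCount_pos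
      have hr := cycleCount_rotation_zero_le (V := V)
      -- Without boundary vertices, Euler's formula gives `2F ≥ #V + 4C` for `C` components; the
      -- extra `2` in `K` is the one in `hF'`. The row is empty, so the choice of `ω` is immaterial.
      refine exists_completes hD hq (ω := cycleOf f (.inr (v, 0))) (K := 4 * D.componentCount + 2)
        (by omega) (fun _ _ _ => by omega) hv rfl (fun h => absurd (by simp) h) fun _ => ?_
      rw [hF]
      simp only [Finset.compl_empty, Finset.card_univ]
      omega
  | succ m =>
    have : Nonempty (HalfEdge (m + 1) V) := ⟨.inl 0⟩
    have hC := D.componentCount_pos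
    have hr := cycleCount_rotation_succ_le (V := V) (m := m)
    -- The boundary counts as one vertex, so `2F ≥ n + #V + 4C - 2`. A part not attached to the
    -- boundary would force `C ≥ 2`, hence `K ≥ 6`. On the sphere the faces at the two ends of the
    -- row are the same face `ω`.
    refine exists_completes hD hq (ω := cycleOf f (D.mate (.inl 0)))
      (K := 4 * D.componentCount - 2) (by omega) (fun U hU hU' => ?_) hv
      (faceChain_ofFn rfl (fun i => ?_) ?_) (fun _ => ?_) (fun h => absurd h (by simp))
    · have := two_le_componentCount hU hU'
      omega
    · rw [← hf, rotation_inl_succ]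
    · rw [← hf, rotation_inl_zero]
    · rw [hF]
      simp only [Finset.compl_empty, Finset.card_univ, List.length_ofFn]
      omega

end SL3Web

namespace SL3Web

variable {n : ℕ} {V : Type*}

/-! ### Weights -/

/-- The order on the weight lattice: the difference is a non-negative combination of the simple
roots. -/
def RootLE (p q : ℤ × ℤ) : Prop :=
  2 * p.1 + p.2 ≤ 2 * q.1 + q.2 ∧ p.1 + 2 * p.2 ≤ q.1 + 2 * q.2

theorem rootLE_weight_one (b : Bool) (s : SignType) : RootLE (weight b s) (weight b 1) := by
  cases b <;> cases s <;> simp [RootLE, weight]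

theorem rootLE_neg_weight (b : Bool) (s : SignType) : RootLE (weight b (-1)) (weight b s) := by
  cases b <;> cases s <;> simp [RootLE, weight]

theorem le_of_rootLE_weight {b : Bool} {s t : SignType} (h : RootLE (weight b s) (weight b t)) :
    s ≤ t := by
  cases b <;> cases s <;> cases t <;> simp [RootLE, weight] at h <;> decide

/-- A state or color seen as color or state, at a strand of sign `b`. -/
def twist (b : Bool) (s : SignType) : SignType := if b then s else -s

theorem twist_twist (b : Bool) (s : SignType) : twist b (twist b s) = s := by
  cases b <;> simp [twist]

theorem twist_injective (b : Bool) : Function.Injective (twist b) :=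
  Function.LeftInverse.injective (twist_twist b)

/-- The weight of the edge of `d` in the coloring `c`, read off at `d`. -/
def edgeWeight (D : SL3Web n V) (c : HalfEdge n V → SignType) (d : HalfEdge n V) : ℤ × ℤ :=
  weight (D.col d) (twist (D.col d) (c d))

/-- The weight of a strand. -/
def strandWeight (D : SL3Web n V) (x : Strand n V) : ℤ × ℤ := weight (D.col x.1) x.2

theorem IsProper.edgeWeight_mate {D : SL3Web n V} {c : HalfEdge n V → SignType} (hc : D.IsProper c)
    (d : HalfEdge n V) : D.edgeWeight c (D.mate d) = -D.edgeWeight c d := by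
  rw [edgeWeight, edgeWeight, hc.1, D.col_mate]
  generalize D.col d = b
  generalize c d = s
  revert b s
  decide

theorem IsProper.ne {D : SL3Web n V} {c : HalfEdge n V → SignType} (hc : D.IsProper c) (v : V)
    {k l : Fin 3} (h : k ≠ l) : c (.inr (v, k)) ≠ c (.inr (v, l)) :=
  fun h' => h (hc.2 v h')

/-- The colors are distinct, so these are the three weights of the standard representation or of its
dual. -/
theorem IsProper.edgeWeight_add {D : SL3Web n V} {c : HalfEdge n V → SignType} (hc : D.IsProper c)
    (v : V) (k : Fin 3) : D.edgeWeight c (.inr (v, k)) + D.edgeWeight c (.inr (v, k + 1)) +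
      D.edgeWeight c (.inr (v, k + 2)) = 0 := by
  have h1 := hc.ne v (fin3_ne_add_one k)
  have h2 := hc.ne v (fin3_ne_add_two k)
  have h3 := hc.ne v (fin3_add_one_ne_add_two k)
  simp only [edgeWeight]
  rw [D.col_inr v (k + 1) k, D.col_inr v (k + 2) k]
  generalize D.col (.inr (v, k)) = b
  revert h1 h2 h3
  generalize c (.inr (v, k)) = x
  generalize c (.inr (v, k + 1)) = y
  generalize c (.inr (v, k + 2)) = z
  revert b x y z
  decide

/-- The total weight of a row of strands. -/
def rowWeight (D : SL3Web n V) (l : List (Strand n V)) : ℤ × ℤ := (l.map D.strandWeight).sum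

/-- The total weight of a row of strands in the coloring `c`, whatever their states. -/
def coloredWeight (D : SL3Web n V) (c : HalfEdge n V → SignType) (l : List (Strand n V)) : ℤ × ℤ :=
  (l.map fun x => D.edgeWeight c x.1).sum

theorem rowWeight_append (D : SL3Web n V) (l l' : List (Strand n V)) :
    D.rowWeight (l ++ l') = D.rowWeight l + D.rowWeight l' := by simp [rowWeight]

theorem coloredWeight_append (D : SL3Web n V) (c : HalfEdge n V → SignType)
    (l l' : List (Strand n V)) :
    D.coloredWeight c (l ++ l') = D.coloredWeight c l + D.coloredWeight c l' := by
  simp [coloredWeight]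

theorem coloredWeight_eq_rowWeight {D : SL3Web n V} {c : HalfEdge n V → SignType}
    {l : List (Strand n V)} (h : ∀ x ∈ l, c x.1 = twist (D.col x.1) x.2) :
    D.coloredWeight c l = D.rowWeight l := by
  rw [coloredWeight, rowWeight]
  congr 1
  refine List.map_congr_left fun x hx => ?_
  rw [edgeWeight, h x hx, twist_twist, strandWeight]

/-! ### Conservation of weight and extremality of the growth states -/

variable [DecidableEq V]

/-- A growth rule preserves the total weight. -/
theorem Rewrite.rowWeight_eq {D : SL3Web n V} {x y : Strand n V} {M W} (h : D.Rewrite x y M W) :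
    D.rowWeight [x, y] = D.rowWeight M := by
  cases h with
  | cap d e a b ha hb h =>
    subst ha hb
    simp only [rowWeight, strandWeight, List.map_cons, List.map_nil, List.sum_cons, List.sum_nil,
      col_eq_not h]
    cases D.col d <;> rfl
  | tri d e v k a b s hs hd he =>
    have h1 := col_eq_not (mate_eq_comm hd)
    have h2 := col_eq_not (mate_eq_comm he)
    rw [D.col_inr v k (k + 2)] at h1
    rw [D.col_inr v (k + 1) (k + 2)] at h2
    simp only [rowWeight, strandWeight, List.map_cons, List.map_nil, List.sum_cons, List.sum_nil,
      h1, h2]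
    rcases ruleY_iff.1 hs with ⟨rfl, rfl, rfl⟩ | ⟨rfl, rfl, rfl⟩ | ⟨rfl, rfl, rfl⟩ <;>
      cases D.col (.inr (v, k + 2)) <;> rfl
  | aitch d e v w k l a b s t hs hd he hvw =>
    have h1 := col_eq_not (mate_eq_comm hd)
    have h2 := col_eq_not (mate_eq_comm he)
    have h3 := col_eq_not hvw
    rw [D.col_inr v k (k + 2)] at h1
    rw [D.col_inr w l (l + 1)] at h2
    rw [D.col_inr v _ (k + 2), D.col_inr w _ (l + 1)] at h3
    simp only [rowWeight, strandWeight, List.map_cons, List.map_nil, List.sum_cons, List.sum_nil,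
      h1, h2, h3]
    rcases ruleH_iff.1 hs with ⟨rfl, rfl, rfl, rfl⟩ | ⟨rfl, rfl, rfl, rfl⟩ | ⟨rfl, rfl, rfl, rfl⟩ <;>
      cases D.col (.inr (v, k + 2)) <;> rfl

/-- Weights cancel along edges and sum to zero at internal vertices, so a proper coloring is a flow
through the piece, whatever the states are. -/
theorem Rewrite.coloredWeight_eq {D : SL3Web n V} {c : HalfEdge n V → SignType} (hc : D.IsProper c)
    {x y : Strand n V} {M W} (h : D.Rewrite x y M W) :
    D.coloredWeight c [x, y] = D.coloredWeight c M := by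
  cases h with
  | cap d e a b ha hb h =>
    simp [coloredWeight, ← h, hc.edgeWeight_mate]
  | tri d e v k a b s hs hd he =>
    have h1 := hc.edgeWeight_mate d
    have h2 := hc.edgeWeight_mate e
    have h3 := hc.edgeWeight_add v k
    rw [hd] at h1
    rw [he] at h2
    rw [h1, h2] at h3
    simp only [coloredWeight, List.map_cons, List.map_nil, List.sum_cons, List.sum_nil, add_zero]
    rw [← sub_eq_zero, ← neg_eq_zero, ← h3]
    abel
  | aitch d e v w k l a b s t hs hd he hvw =>
    have h1 := hc.edgeWeight_mate d
    have h2 := hc.edgeWeight_mate e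
    have h3 := hc.edgeWeight_add v k
    have h4 := hc.edgeWeight_add w l
    have h5 := hc.edgeWeight_mate (.inr (v, k + 1))
    rw [hd] at h1
    rw [he] at h2
    rw [hvw] at h5
    rw [h1] at h3
    rw [h2, h5] at h4
    simp only [coloredWeight, List.map_cons, List.map_nil, List.sum_cons, List.sum_nil, add_zero]
    rw [← sub_eq_zero, ← neg_eq_zero, ← add_zero (0 : ℤ × ℤ)]
    nth_rewrite 1 [← h3]
    rw [← h4]
    abel

omit [DecidableEq V] in
-- If `c` reads as state `0` or `-1` at `d`, then `h0` suffices. If it reads as `1`, properness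
-- keeps the new strand at `v` off its lowest state `-1`, and the resulting slack in `h1` makes up
-- the difference.
theorem rootLE_add_of_zero {D : SL3Web n V} {c : HalfEdge n V → SignType} (hc : D.IsProper c)
    {d : HalfEdge n V} {v : V} {k : Fin 3} (hd : D.mate d = .inr (v, k)) {P Q : ℤ × ℤ}
    (h0 : RootLE P Q) (h1 : RootLE (P + D.edgeWeight c (.inr (v, k + 2)))
      (Q + weight (D.col (.inr (v, k + 2))) (-1))) :
    RootLE (P + D.edgeWeight c d) (Q + weight (D.col d) 0) := by
  have h2 := col_eq_not (mate_eq_comm hd)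
  have h3 := hc.ne v (fin3_ne_add_two k)
  have h4 := hc.1 d
  rw [hd] at h4
  rw [h4] at h3
  rw [D.col_inr v k (k + 2)] at h2
  rw [edgeWeight] at h1 ⊢
  rw [h2]
  revert h3 h1
  generalize D.col (.inr (v, k + 2)) = b
  generalize c (.inr (v, k + 2)) = s
  generalize c d = t
  rcases P with ⟨p, p'⟩
  rcases Q with ⟨q, q'⟩
  intro h1 h3
  cases b <;> cases s <;> cases t <;> simp [RootLE, weight, twist] at h0 h1 h3 ⊢ <;> omega

/-- The weight to the left of the middle of a growth rule is the largest possible one, if the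
weights after the application of the rule are. -/
theorem Rewrite.rootLE_middle {D : SL3Web n V} {c : HalfEdge n V → SignType} (hc : D.IsProper c)
    {x y : Strand n V} {M W} (h : D.Rewrite x y M W) {P Q : ℤ × ℤ}
    (hM : ∀ A B, M = A ++ B → RootLE (P + D.coloredWeight c A) (Q + D.rowWeight A)) :
    RootLE (P + D.edgeWeight c x.1) (Q + D.strandWeight x) := by
  -- In each rule the left state is `1`, so the highest weight is added; or the right state is `-1`,
  -- so the lowest weight is taken away from the total; or it is the H under `0, 0`, handled by
  -- `rootLE_add_of_zero`.
  have h0 : RootLE P Q := by simpa [coloredWeight, rowWeight] using hM [] M rfl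
  have h1 : x.2 = 1 → RootLE (P + D.edgeWeight c x.1) (Q + D.strandWeight x) := by
    intro hx
    have := rootLE_weight_one (D.col x.1) (twist (D.col x.1) (c x.1))
    rw [edgeWeight, strandWeight, hx]
    simp only [RootLE, Prod.fst_add, Prod.snd_add] at *
    omega
  have h2 : y.2 = -1 → RootLE (P + D.edgeWeight c x.1) (Q + D.strandWeight x) := by
    intro hy
    have h3 := hM M [] (by simp)
    rw [← h.rowWeight_eq, ← h.coloredWeight_eq hc] at h3
    have := rootLE_neg_weight (D.col y.1) (twist (D.col y.1) (c y.1))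
    simp only [coloredWeight, rowWeight, List.map_cons, List.map_nil, List.sum_cons, List.sum_nil,
      add_zero] at h3
    rw [show D.strandWeight y = weight (D.col y.1) (-1) by rw [strandWeight, hy],
      show D.edgeWeight c y.1 = weight (D.col y.1) (twist (D.col y.1) (c y.1)) from rfl] at h3
    simp only [RootLE, Prod.fst_add, Prod.snd_add] at *
    omega
  cases h with
  | cap d e a b ha hb h => exact h1 ha
  | tri d e v k a b s hs hd he =>
    rcases ruleY_iff.1 hs with h | h | h
    exacts [h1 h.1, h2 h.2.1, h1 h.1]
  | aitch d e v w k l a b s t hs hd he hvw =>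
    rcases ruleH_iff.1 hs with h | h | h
    · exact h1 h.1
    · obtain ⟨rfl, rfl, rfl, rfl⟩ := h
      refine rootLE_add_of_zero hc hd h0 ?_
      simpa [coloredWeight, rowWeight, strandWeight] using hM [(.inr (v, k + 2), -1)] _ rfl
    · exact h2 h.2.1

/-- The same three cases as in `Rewrite.rootLE_middle`. For the H under `0, 0`, the weight of `x`
exceeds that of the new left strand by a dominant weight. -/
theorem Rewrite.nonneg_middle {D : SL3Web n V} {x y : Strand n V} {M W} (h : D.Rewrite x y M W)
    {Q : ℤ × ℤ} (hM : ∀ A B, M = A ++ B → 0 ≤ Q + D.rowWeight A) : 0 ≤ Q + D.strandWeight x := by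
  have h0 : 0 ≤ Q := by simpa [rowWeight] using hM [] M rfl
  have h1 : x.2 = 1 → 0 ≤ Q + D.strandWeight x := by
    intro hx
    refine add_nonneg h0 ?_
    rw [strandWeight, hx]
    cases D.col x.1 <;> decide
  have h2 : y.2 = -1 → 0 ≤ Q + D.strandWeight x := by
    intro hy
    have h3 := hM M [] (by simp)
    rw [← h.rowWeight_eq] at h3
    have h4 : 0 ≤ -D.strandWeight y := by
      rw [strandWeight, hy]
      cases D.col y.1 <;> decide
    have := add_nonneg h3 h4
    simp only [rowWeight, List.map_cons, List.map_nil, List.sum_cons, List.sum_nil,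
      add_zero] at this
    rwa [show Q + (D.strandWeight x + D.strandWeight y) + -D.strandWeight y =
      Q + D.strandWeight x by abel] at this
  cases h with
  | cap d e a b ha hb h => exact h1 ha
  | tri d e v k a b s hs hd he =>
    rcases ruleY_iff.1 hs with h | h | h
    exacts [h1 h.1, h2 h.2.1, h1 h.1]
  | aitch d e v w k l a b s t hs hd he hvw =>
    rcases ruleH_iff.1 hs with h | h | h
    · exact h1 h.1
    · obtain ⟨rfl, rfl, rfl, rfl⟩ := h
      have h3 := hM [(.inr (v, k + 2), -1)] _ rfl
      have h4 := col_eq_not hd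
      rw [D.col_inr v _ (k + 2)] at h4
      simp only [rowWeight, List.map_cons, List.map_nil, List.sum_cons, List.sum_nil,
        add_zero, strandWeight, h4] at h3 ⊢
      have h5 : 0 ≤ weight (D.col d) 0 - weight (!D.col d) (-1) := by
        cases D.col d <;> decide
      have := add_nonneg h3 h5
      rwa [add_add_sub_cancel] at this
    · exact h2 h.2.1

omit [DecidableEq V] in
theorem append_eq_append_pair {α : Type*} {A B L R : List α} {x y : α}
    (h : L ++ x :: y :: R = A ++ B) :
    (∃ A', L = A ++ A') ∨ A = L ++ [x] ∨ ∃ A', A = L ++ x :: y :: A' ∧ R = A' ++ B := by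
  rcases List.append_eq_append_iff.1 h with ⟨C, h1, h2⟩ | ⟨C, h1, h2⟩
  · rcases C with _ | ⟨a, _ | ⟨b, C⟩⟩ <;> simp at h1 h2
    · exact .inl ⟨[], by simp [h1]⟩
    · exact .inr (.inl (by simp [h1, h2]))
    · exact .inr (.inr ⟨C, by simp [h1, h2], by simp [h2]⟩)
  · exact .inl ⟨C, h1⟩

variable [Fintype V]

/-- The states in the growth algorithm give the largest weights of all proper colorings. -/
theorem Completes.rootLE {D : SL3Web n V} {c : HalfEdge n V → SignType} (hc : D.IsProper c)
    {l : List (Strand n V)} {U : Finset V} (h : D.Completes l U) :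
    ∀ A B, l = A ++ B → RootLE (D.coloredWeight c A) (D.rowWeight A) := by
  induction h with
  | done =>
    intro A B h
    obtain ⟨rfl, rfl⟩ := List.append_eq_nil_iff.1 h.symm
    simp [coloredWeight, rowWeight, RootLE]
  | step L R x y M W U h hU hcp ih =>
    intro A B hAB
    -- A cut of the row outside the pair is also a cut after the rule, with the same weights to its
    -- left; only the cut between `x` and `y` is new.
    rcases append_eq_append_pair hAB with ⟨A', rfl⟩ | rfl | ⟨A', rfl, rfl⟩
    · exact ih A (A' ++ M ++ R) (by simp)
    · rw [coloredWeight_append, rowWeight_append]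
      have := h.rootLE_middle hc (P := D.coloredWeight c L) (Q := D.rowWeight L) fun A B hM => by
        have := ih (L ++ A) (B ++ R) (by simp [hM])
        rwa [coloredWeight_append, rowWeight_append] at this
      simpa [rowWeight, coloredWeight] using this
    · have h1 := ih (L ++ M ++ A') B (by simp)
      rw [show L ++ x :: y :: A' = L ++ [x, y] ++ A' by simp]
      simpa only [rowWeight_append, coloredWeight_append, h.rowWeight_eq, h.coloredWeight_eq hc]
        using h1

theorem Completes.nonneg {D : SL3Web n V} {l : List (Strand n V)} {U : Finset V}
    (h : D.Completes l U) : ∀ A B, l = A ++ B → 0 ≤ D.rowWeight A := by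
  induction h with
  | done =>
    intro A B h
    obtain ⟨rfl, rfl⟩ := List.append_eq_nil_iff.1 h.symm
    simp [rowWeight]
  | step L R x y M W U h hU hcp ih =>
    intro A B hAB
    rcases append_eq_append_pair hAB with ⟨A', rfl⟩ | rfl | ⟨A', rfl, rfl⟩
    · exact ih A (A' ++ M ++ R) (by simp)
    · rw [rowWeight_append]
      have := h.nonneg_middle (Q := D.rowWeight L) fun A B hM => by
        have := ih (L ++ A) (B ++ R) (by simp [hM])
        rwa [rowWeight_append] at this
      simpa [rowWeight] using this
    · have h1 := ih (L ++ M ++ A') B (by simp)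
      rw [show L ++ x :: y :: A' = L ++ [x, y] ++ A' by simp]
      simpa only [rowWeight_append, h.rowWeight_eq] using h1

theorem Completes.rowWeight_eq_zero {D : SL3Web n V} {l : List (Strand n V)} {U : Finset V}
    (h : D.Completes l U) : D.rowWeight l = 0 := by
  induction h with
  | done => simp [rowWeight]
  | step L R x y M W U h hU hcp ih =>
    rw [show L ++ x :: y :: R = L ++ [x, y] ++ R by simp]
    simpa only [rowWeight_append, h.rowWeight_eq] using ih

/-- The lattice path of a state string that completes is dominant. -/
theorem Completes.isDominant {D : SL3Web n V} {J : Fin n → SignType}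
    (h : D.Completes (List.ofFn fun i => ((.inl i : HalfEdge n V), J i)) ∅) :
    IsDominant (fun i => D.black (.inl i)) J := by
  have hw : (List.ofFn fun i => ((.inl i : HalfEdge n V), J i)).map D.strandWeight =
      List.ofFn fun i => weight (D.black (.inl i)) (J i) := by
    rw [List.map_ofFn]
    rfl
  refine ⟨fun k => ?_, ?_⟩
  · have := h.nonneg _ _ (List.take_append_drop k _).symm
    rwa [rowWeight, List.map_take, hw, List.sum_take_ofFn] at this
  · have := h.rowWeight_eq_zero
    rwa [rowWeight, hw, List.sum_ofFn] at this

end SL3Web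

namespace SL3Web

variable {n : ℕ} {V : Type*}

/-! ### Colorings with given states -/

/-- The coloring `c` has the prescribed states on the strands in `l`. -/
def Realizes (D : SL3Web n V) (c : HalfEdge n V → SignType) (l : List (Strand n V)) : Prop :=
  ∀ x ∈ l, c x.1 = twist (D.col x.1) x.2

theorem realizes_append {D : SL3Web n V} {c : HalfEdge n V → SignType} {l l' : List (Strand n V)} :
    D.Realizes c (l ++ l') ↔ D.Realizes c l ∧ D.Realizes c l' := by
  simp only [Realizes, List.mem_append]
  exact ⟨fun h => ⟨fun x hx => h x (.inl hx), fun x hx => h x (.inr hx)⟩,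
    fun h x hx => hx.elim (h.1 x) (h.2 x)⟩

variable [DecidableEq V] [Fintype V]

/-- The states below a growth rule are determined by those above it. -/
theorem Rewrite.realizes {D : SL3Web n V} {c : HalfEdge n V → SignType} (hc : D.IsProper c)
    {L R : List (Strand n V)} {x y : Strand n V} {M W} {U : Finset V} (h : D.Rewrite x y M W)
    (hcp : D.Completes (L ++ M ++ R) U) (hl : D.Realizes c (L ++ x :: y :: R)) :
    D.Realizes c (L ++ M ++ R) := by
  rw [show L ++ x :: y :: R = L ++ [x, y] ++ R by simp, realizes_append, realizes_append] at hl
  obtain ⟨⟨hL, hxy⟩, hR⟩ := hl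
  rw [realizes_append, realizes_append]
  refine ⟨⟨hL, ?_⟩, hR⟩
  have hx := hxy x (by simp)
  have hy := hxy y (by simp)
  cases h with
  | cap d e a b ha hb h => intro z hz; simp at hz
  | tri d e v k a b s hs hd he =>
    intro z hz
    obtain rfl := List.mem_singleton.1 hz
    have h1 := col_eq_not (mate_eq_comm hd)
    have h2 := col_eq_not (mate_eq_comm he)
    have h3 := hc.1 d
    have h4 := hc.1 e
    have h5 := hc.ne v (fin3_ne_add_two k)
    have h6 := hc.ne v (fin3_add_one_ne_add_two k)
    rw [D.col_inr v k (k + 2)] at h1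
    rw [D.col_inr v (k + 1) (k + 2)] at h2
    rw [hd] at h3
    rw [he] at h4
    dsimp only at hx hy ⊢
    rw [h3, hx, h1] at h5
    rw [h4, hy, h2] at h6
    revert h5 h6
    generalize D.col (.inr (v, k + 2)) = β
    generalize c (.inr (v, k + 2)) = t
    rcases ruleY_iff.1 hs with ⟨rfl, rfl, rfl⟩ | ⟨rfl, rfl, rfl⟩ | ⟨rfl, rfl, rfl⟩ <;>
      (clear * -; revert β t; decide)
  | aitch d e v w k l a b s t hs hd he hvw =>
    have h1 := col_eq_not (mate_eq_comm hd)
    have h2 := col_eq_not (mate_eq_comm he)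
    have h3 := col_eq_not hvw
    have h4 := hc.1 d
    have h5 := hc.1 e
    have h6 := hc.1 (.inr (v, k + 1))
    have h7 := hc.ne v (fin3_ne_add_two k)
    have h8 := hc.ne v (fin3_ne_add_one k)
    have h9 := hc.ne v (fin3_add_one_ne_add_two k)
    have h10 := hc.ne w (fin3_ne_add_one l)
    have h11 := hc.ne w (fin3_ne_add_two l)
    have h12 := hc.ne w (fin3_add_one_ne_add_two l)
    rw [D.col_inr v k (k + 2)] at h1
    rw [D.col_inr w l (l + 1)] at h2
    rw [D.col_inr v (k + 1) (k + 2), D.col_inr w (l + 2) (l + 1)] at h3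
    rw [hd] at h4
    rw [he] at h5
    rw [hvw] at h6
    dsimp only at hx hy
    rw [h6] at h11 h12
    rw [h4, hx, h1] at h7 h8
    rw [h5, hy, h2, h3] at h10 h11
    -- Under top states `0, 0` the edges `d` and `e` have the same color, and properness leaves two
    -- choices for the horizontal edge. The weight bound picks the one in which the strand from `v`
    -- has state `-1`.
    have hmid : a = 0 → b = 0 → twist (D.col (.inr (v, k + 2))) (c (.inr (v, k + 2))) = -1 := by
      rintro rfl rfl
      have hs : s = -1 := by
        rcases ruleH_iff.1 hs with h | h | h
        · simp at h
        · exact h.2.2.1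
        · simp at h
      subst hs
      have h13 := hcp.rootLE hc (L ++ [(.inr (v, k + 2), -1)]) ((.inr (w, l + 1), t) :: R)
        (by simp)
      rw [coloredWeight_append, rowWeight_append, coloredWeight_eq_rowWeight hL] at h13
      have h14 : RootLE (D.edgeWeight c (.inr (v, k + 2)))
          (weight (D.col (.inr (v, k + 2))) (-1)) := by
        simp only [coloredWeight, rowWeight, List.map_cons, List.map_nil, List.sum_cons,
          List.sum_nil, add_zero, strandWeight] at h13
        simpa only [RootLE, Prod.fst_add, Prod.snd_add, mul_add, add_assoc, add_left_comm,
          add_le_add_iff_left] using h13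
      exact le_antisymm (le_of_rootLE_weight h14)
        ((by decide : ∀ s : SignType, -1 ≤ s) _)
    suffices hsuff : c (.inr (v, k + 2)) = twist (D.col (.inr (v, k + 2))) s ∧
        c (.inr (w, l + 1)) = twist (D.col (.inr (w, l + 1))) t by
      intro z hz
      rcases List.mem_cons.1 hz with rfl | hz
      · exact hsuff.1
      · obtain rfl := List.mem_singleton.1 hz
        exact hsuff.2
    rw [h3]
    revert h7 h8 h9 h10 h11 h12 hmid
    generalize D.col (.inr (v, k + 2)) = β
    generalize c (.inr (v, k + 1)) = p
    generalize c (.inr (v, k + 2)) = q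
    generalize c (.inr (w, l + 1)) = r
    rcases ruleH_iff.1 hs with ⟨rfl, rfl, rfl, rfl⟩ | ⟨rfl, rfl, rfl, rfl⟩ | ⟨rfl, rfl, rfl, rfl⟩ <;>
      (clear * -; revert β p q r; decide)

theorem eq_of_ne_of_ne {a b c c' : SignType} (hab : a ≠ b) (h1 : a ≠ c) (h2 : c ≠ b) (h1' : a ≠ c')
    (h2' : c' ≠ b) : c = c' := by
  revert a b c c'
  decide

/-- A coloring is determined by the states of the strands. -/
theorem Completes.eq_of_realizes {D : SL3Web n V} {c c' : HalfEdge n V → SignType}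
    (hc : D.IsProper c) (hc' : D.IsProper c') {l : List (Strand n V)} {U : Finset V}
    (h : D.Completes l U) (hl : D.Realizes c l) (hl' : D.Realizes c' l) :
    ∀ v ∉ U, ∀ k, c (.inr (v, k)) = c' (.inr (v, k)) := by
  induction h with
  | done => intro v hv; simp at hv
  | step L R x y M W U h hU hcp ih =>
    intro v hv j
    have hM := h.realizes hc hcp hl
    have hM' := h.realizes hc' hcp hl'
    by_cases hvW : v ∈ W
    · have hx : c (D.mate x.1) = c' (D.mate x.1) := by
        rw [hc.1, hc'.1, hl x (by simp), hl' x (by simp)]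
      have hy : c (D.mate y.1) = c' (D.mate y.1) := by
        rw [hc.1, hc'.1, hl y (by simp), hl' y (by simp)]
      have hz : ∀ z ∈ M, c z.1 = c' z.1 := by
        intro z hz
        rw [hM z (by simp [hz]), hM' z (by simp [hz])]
      cases h with
      | cap => simp at hvW
      | tri d e u k a b s hs hd he =>
        obtain rfl := Finset.mem_singleton.1 hvW
        dsimp only at hx hy
        rw [hd] at hx
        rw [he] at hy
        rcases fin3_cases k j with rfl | rfl | rfl
        exacts [hx, hy, hz (.inr (v, k + 2), s) (by simp)]
      | aitch d e u w k l a b s t hs hd he huw =>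
        dsimp only at hx hy
        rw [hd] at hx
        rw [he] at hy
        have h1 := hz (.inr (u, k + 2), s) (by simp)
        have h2 := hz (.inr (w, l + 1), t) (by simp)
        have h3 : c (.inr (u, k + 1)) = c' (.inr (u, k + 1)) := by
          have h4 := hc'.ne u (fin3_ne_add_one k)
          have h5 := hc'.ne u (fin3_add_one_ne_add_two k)
          rw [← hx] at h4
          rw [← h1] at h5
          exact eq_of_ne_of_ne (hc.ne u (fin3_ne_add_two k)) (hc.ne u (fin3_ne_add_one k))
            (hc.ne u (fin3_add_one_ne_add_two k)) h4 h5
        simp only [Finset.mem_insert, Finset.mem_singleton] at hvW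
        rcases hvW with rfl | rfl
        · rcases fin3_cases k j with rfl | rfl | rfl
          exacts [hx, h3, h1]
        · rcases fin3_cases l j with rfl | rfl | rfl
          · exact hy
          · exact h2
          · rw [← huw, hc.1, hc'.1, h3]
    · exact ih hM hM' v (by simp [hv, hvW]) j

/-! ### Lexicographic minimality -/

/-- The coloring of a completed growth is the lexicographic minimum. -/
theorem Completes.lexLT {D : SL3Web n V} {c c' : HalfEdge n V → SignType} (hc : D.IsProper c)
    (hc' : D.IsProper c') {J : Fin n → SignType}
    (h : D.Completes (List.ofFn fun i => ((.inl i : HalfEdge n V), J i)) ∅)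
    (hJ : D.Realizes c (List.ofFn fun i => (.inl i, J i))) (hne : c' ≠ c) : D.LexLT c c' := by
  classical
  by_cases hb : ∀ i : Fin n, c (.inl i) = c' (.inl i)
  · refine absurd ?_ hne
    have hJ' : D.Realizes c' (List.ofFn fun i => (.inl i, J i)) := by
      intro x hx
      obtain ⟨i, rfl⟩ := List.mem_ofFn.1 hx
      dsimp only
      rw [← hb, hJ _ hx]
    funext x
    rcases x with i | ⟨v, k⟩
    · exact (hb i).symm
    · exact h.eq_of_realizes hc' hc hJ' hJ v (by simp) k
  push Not at hb
  obtain ⟨i, hi, hmin⟩ : ∃ i : Fin n, c (.inl i) ≠ c' (.inl i) ∧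
      ∀ j < i, c (.inl j) = c' (.inl j) := by
    obtain ⟨i, hi, hmin⟩ := WellFounded.has_min (wellFounded_lt (α := Fin n))
      {i | c (.inl i) ≠ c' (.inl i)} hb
    exact ⟨i, hi, fun j hj => not_not.1 fun h => hmin j h hj⟩
  refine ⟨i, hmin, ?_⟩
  generalize hl : (List.ofFn fun i => ((.inl i : HalfEdge n V), J i)) = l at h hJ
  have hlen : i.1 < l.length := by simp [← hl]
  have hget : l[i.1] = (.inl i, J i) := by simp [← hl]
  have hJi := hJ _ (List.getElem_mem hlen)
  rw [hget] at hJi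
  -- Before `i` the weights of `c'` and of the states agree, so the bound on the segment ending at
  -- `i` compares the two states at `i`.
  have h1 := h.rootLE hc' (l.take i.1 ++ [l[i.1]]) (l.drop (i.1 + 1)) (by simp)
  have h2 : D.coloredWeight c' (l.take i.1) = D.rowWeight (l.take i.1) := by
    refine coloredWeight_eq_rowWeight fun x hx => ?_
    rw [← hJ x (List.mem_of_mem_take hx)]
    obtain ⟨j, hj, rfl⟩ := List.mem_take_iff_getElem.1 hx
    have hj' : j < i.1 := by omega
    simp only [← hl, List.getElem_ofFn]
    exact (hmin ⟨j, hj'.trans i.2⟩ hj').symm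
  rw [coloredWeight_append, rowWeight_append, h2, hget] at h1
  have h3 : RootLE (D.edgeWeight c' (.inl i)) (weight (D.col (.inl i : HalfEdge n V)) (J i)) := by
    simp only [coloredWeight, rowWeight, List.map_cons, List.map_nil, List.sum_cons,
      List.sum_nil, add_zero, strandWeight] at h1
    simpa only [RootLE, Prod.fst_add, Prod.snd_add, mul_add, add_assoc, add_left_comm,
      add_le_add_iff_left] using h1
  have h4 := le_of_rootLE_weight h3
  have h5 : J i = twist (D.col (.inl i : HalfEdge n V)) (c (.inl i)) := by
    rw [hJi, twist_twist]
  rw [h5] at h4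
  have hcol : D.black (.inl i) = D.col (.inl i : HalfEdge n V) := rfl
  -- At each boundary vertex the order of colors is the reverse of the order of states.
  simp only [ColorLT, hcol]
  revert h4 hi
  generalize D.col (.inl i : HalfEdge n V) = β
  generalize c (.inl i) = s
  generalize c' (.inl i) = t
  clear * -
  revert β s t
  decide

/-! ### Existence of the coloring -/

omit [Fintype V] in
theorem Rewrite.peel {D : SL3Web n V} {x y : Strand n V} {M W} (h : D.Rewrite x y M W) :
    D.Peel x.1 y.1 (M.map Prod.fst) W := by
  cases h with
  | cap d e a b ha hb h => exact .cap _ _ h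
  | tri d e v k a b s hs hd he => exact .tri _ _ v k hd he
  | aitch d e v w k l a b s t hs hd he hvw => exact .aitch _ _ v w k l hd he hvw

/-- A coloring of the live part of a web, with the states of the strands in `l`. -/
structure IsLiveColoring (D : SL3Web n V) (l : List (Strand n V)) (U : Finset V)
    (c : HalfEdge n V → SignType) : Prop where
  realizes : D.Realizes c l
  mate_eq : ∀ x ∈ live (l.map Prod.fst) U, c (D.mate x) = c x
  injective : ∀ v ∉ U, Function.Injective fun k : Fin 3 => c (.inr (v, k))

theorem injective_fin3 {f : Fin 3 → SignType} (k : Fin 3) (h1 : f k ≠ f (k + 1))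
    (h2 : f k ≠ f (k + 2)) (h3 : f (k + 1) ≠ f (k + 2)) : Function.Injective f := by
  intro i j hij
  rcases fin3_cases k i with hi | hi | hi <;> rcases fin3_cases k j with hj | hj | hj <;>
    rw [hi, hj] at hij <;>
    first
    | exact hi.trans hj.symm
    | exact absurd hij (by assumption)
    | exact absurd hij.symm (by assumption)

/-- The color of the horizontal edge in a growth rule. -/
theorem RuleH.exists_color {a b s t : SignType} (h : RuleH a b s t) (β : Bool) :
    ∃ p, twist β a ≠ p ∧ p ≠ twist (!β) s ∧ twist β a ≠ twist (!β) s ∧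
      twist (!β) b ≠ p ∧ twist β t ≠ p ∧ twist (!β) b ≠ twist β t := by
  rcases ruleH_iff.1 h with ⟨rfl, rfl, rfl, rfl⟩ | ⟨rfl, rfl, rfl, rfl⟩ | ⟨rfl, rfl, rfl, rfl⟩ <;>
    (clear * -; revert β; decide)

theorem RuleY.colors_ne {a b s : SignType} (h : RuleY a b s) (β : Bool) :
    twist β a ≠ twist β b ∧ twist β a ≠ twist (!β) s ∧ twist β b ≠ twist (!β) s := by
  rcases ruleY_iff.1 h with ⟨rfl, rfl, rfl⟩ | ⟨rfl, rfl, rfl⟩ | ⟨rfl, rfl, rfl⟩ <;>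
    (clear * -; revert β; decide)

theorem Rewrite.live_subset {D : SL3Web n V} {L R : List (Strand n V)} {x y : Strand n V} {M W}
    {U : Finset V} (h : D.Rewrite x y M W) (hU : Disjoint U W)
    (hv : D.Valid ((L ++ x :: y :: R).map Prod.fst) U) :
    live ((L ++ M ++ R).map Prod.fst) (W ∪ U) ⊆ live ((L ++ x :: y :: R).map Prod.fst) U := by
  simp only [List.map_append, List.map_cons] at hv ⊢
  obtain ⟨G, -, h2, -⟩ := h.peel.exists_removed hU hv
  rw [h2]
  exact Finset.sdiff_subset

theorem Rewrite.valid {D : SL3Web n V} {L R : List (Strand n V)} {x y : Strand n V} {M W}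
    {U : Finset V} (h : D.Rewrite x y M W) (hU : Disjoint U W)
    (hv : D.Valid ((L ++ x :: y :: R).map Prod.fst) U) :
    D.Valid ((L ++ M ++ R).map Prod.fst) (W ∪ U) := by
  simp only [List.map_append, List.map_cons] at hv ⊢
  exact h.peel.valid hU hv

/-- A coloring of the part below a growth rule extends to the growth rule. -/
theorem Rewrite.exists_isLiveColoring {D : SL3Web n V} {L R : List (Strand n V)} {x y : Strand n V}
    {M W} {U : Finset V} (h : D.Rewrite x y M W) (hU : Disjoint U W)
    (hv : D.Valid ((L ++ x :: y :: R).map Prod.fst) U) {c' : HalfEdge n V → SignType}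
    (hc' : D.IsLiveColoring (L ++ M ++ R) (W ∪ U) c') :
    ∃ c, D.IsLiveColoring (L ++ x :: y :: R) U c ∧
      ∀ z ∈ live ((L ++ M ++ R).map Prod.fst) (W ∪ U), c z = c' z := by
  have hv' := h.valid hU hv
  have hsub := h.live_subset hU hv
  set r := (L ++ x :: y :: R).map Prod.fst with hr
  set Λ := live ((L ++ M ++ R).map Prod.fst) (W ∪ U) with hΛ
  have hcl : ∀ z, D.mate z ∈ Λ ↔ z ∈ Λ := fun z =>
    ⟨fun h => by have := hv'.closed _ h; rwa [D.mate_mate] at this, hv'.closed z⟩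
  have hxl : x.1 ∈ r := by simp [hr]
  have hyl : y.1 ∈ r := by simp [hr]
  have hnd := hv.nodup
  simp only [hr, List.map_append, List.map_cons, List.nodup_append, List.nodup_cons, List.mem_cons,
    not_or, forall_eq_or_imp] at hnd
  obtain ⟨-, ⟨⟨hxy, hxR⟩, hyR, -⟩, hLR⟩ := hnd
  have hxL : x.1 ∉ L.map Prod.fst := fun h => (hLR _ h).1 rfl
  have hyL : y.1 ∉ L.map Prod.fst := fun h => (hLR _ h).2.1 rfl
  have hWU : ∀ v ∈ W, v ∉ U := fun v hvW hvU => Finset.disjoint_left.1 hU hvU hvW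
  have hMW : ∀ z ∈ M, ∃ v ∈ W, ∃ k, z.1 = .inr (v, k) := by
    cases h with
    | cap => simp
    | tri => simp
    | aitch => simp
  have hlM : ∀ z ∈ r, z ∉ M.map Prod.fst := by
    intro z hz hzM
    obtain ⟨m, hm, rfl⟩ := List.mem_map.1 hzM
    obtain ⟨v, hvW, k, hk⟩ := hMW m hm
    exact hv.ne_inr (hWU v hvW) k hz hk
  have hxΛ : x.1 ∉ Λ := by
    rw [hΛ, mem_live]
    rintro (h1 | ⟨v, k, hvU, h1⟩)
    · simp only [List.map_append, List.mem_append] at h1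
      exact h1.elim (fun h1 => h1.elim hxL (hlM _ hxl)) hxR
    · exact hv.ne_inr (fun h => hvU (Finset.mem_union_right _ h)) k hxl h1
  have hyΛ : y.1 ∉ Λ := by
    rw [hΛ, mem_live]
    rintro (h1 | ⟨v, k, hvU, h1⟩)
    · simp only [List.map_append, List.mem_append] at h1
      exact h1.elim (fun h1 => h1.elim hyL (hlM _ hyl)) hyR
    · exact hv.ne_inr (fun h => hvU (Finset.mem_union_right _ h)) k hyl h1
  have hWΛ : ∀ v ∈ W, ∀ k, .inr (v, k) ∈ Λ → .inr (v, k) ∈ M.map Prod.fst := by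
    intro v hvW k h1
    rw [hΛ, mem_live] at h1
    rcases h1 with h1 | ⟨u, j, hu, h1⟩
    · simp only [List.map_append, List.mem_append] at h1
      rcases h1 with (h1 | h1) | h1
      · exact absurd rfl (hv.ne_inr (hWU v hvW) k (x := .inr (v, k)) (by simp [hr] at h1 ⊢; tauto))
      · exact h1
      · exact absurd rfl (hv.ne_inr (hWU v hvW) k (x := .inr (v, k)) (by simp [hr] at h1 ⊢; tauto))
    · obtain ⟨rfl, rfl⟩ := Prod.mk.inj (Sum.inr.inj h1)
      exact absurd (Finset.mem_union_left _ hvW) hu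
  have hMΛ : ∀ z ∈ M, z.1 ∈ Λ := fun z hz => by
    rw [hΛ, mem_live]
    exact .inl (List.mem_map_of_mem (by simp [hz]))
  -- the coloring with horizontal color `p`
  let C : SignType → HalfEdge n V → SignType := fun p z =>
    if z ∈ Λ then c' z
    else if z = x.1 ∨ z = D.mate x.1 then twist (D.col x.1) x.2
    else if z = y.1 ∨ z = D.mate y.1 then twist (D.col y.1) y.2
    else p
  have hCΛ : ∀ p, ∀ z ∈ Λ, C p z = c' z := fun p z hz => by simp only [C, if_pos hz]
  have hCx : ∀ p, C p x.1 = twist (D.col x.1) x.2 := fun p => by simp [C, hxΛ]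
  have hmate : ∀ p z, z ∈ live r U → C p (D.mate z) = C p z := by
    intro p z hz
    have e1 : ∀ w, (D.mate z = w ∨ D.mate z = D.mate w) ↔ (z = w ∨ z = D.mate w) := by
      intro w
      rw [D.mate_injective.eq_iff, or_comm]
      refine or_congr_right ⟨fun h => by rw [← h, D.mate_mate], fun h => by rw [h, D.mate_mate]⟩
    by_cases hzΛ : z ∈ Λ
    · rw [hCΛ p z hzΛ, hCΛ p _ ((hcl z).2 hzΛ), hc'.mate_eq z hzΛ]
    · simp only [C, hcl, e1, if_neg hzΛ]
  have hreal : ∀ p, C p y.1 = twist (D.col y.1) y.2 → D.Realizes (C p) (L ++ x :: y :: R) := by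
    intro p hy z hz
    have hmem : z ∈ L ++ M ++ R → C p z.1 = twist (D.col z.1) z.2 := fun hz => by
      rw [hCΛ, hc'.realizes z hz]
      exact mem_live.2 (.inl (List.mem_map_of_mem hz))
    simp only [List.mem_append, List.mem_cons] at hz
    rcases hz with hz | rfl | rfl | hz
    · exact hmem (by simp [hz])
    · exact hCx p
    · exact hy
    · exact hmem (by simp [hz])
  have hinj : ∀ p, ∀ v ∉ W ∪ U, Function.Injective fun k : Fin 3 => C p (.inr (v, k)) := by
    intro p v hvU
    have : (fun k : Fin 3 => C p (.inr (v, k))) = fun k => c' (.inr (v, k)) := by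
      funext k
      exact hCΛ p _ (inr_mem_live hvU k)
    rw [this]
    exact hc'.injective v hvU
  suffices hsuff : ∃ p, C p y.1 = twist (D.col y.1) y.2 ∧
      ∀ v ∈ W, Function.Injective fun k : Fin 3 => C p (.inr (v, k)) by
    obtain ⟨p, hp1, hp2⟩ := hsuff
    refine ⟨C p, ⟨hreal p hp1, hmate p, fun v hvU => ?_⟩, hCΛ p⟩
    by_cases hvW : v ∈ W
    · exact hp2 v hvW
    · exact hinj p v (by simp [hvU, hvW])
  have hmatex : ∀ p, C p (D.mate x.1) = twist (D.col x.1) x.2 := fun p => by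
    rw [hmate p x.1 (mem_live.2 (.inl hxl)), hCx]
  have hy' : y.1 ≠ D.mate x.1 → ∀ p, C p y.1 = twist (D.col y.1) y.2 := fun h p => by
    simp [C, hyΛ, h, Ne.symm hxy]
  have hmatey : y.1 ≠ D.mate x.1 → ∀ p, C p (D.mate y.1) = twist (D.col y.1) y.2 := fun h p => by
    rw [hmate p y.1 (mem_live.2 (.inl hyl)), hy' h]
  cases h with
  | cap d e a b ha hb h =>
    refine ⟨0, ?_, by simp⟩
    dsimp only at hmatex ⊢
    rw [← h, hmatex, D.col_mate, ha, hb]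
    cases D.col d <;> rfl
  | tri d e v k a b s hs hd he =>
    have hvU := hWU v (by simp)
    dsimp only at hxl hyl hmatex hmatey hy' hCx
    have hyx : e ≠ D.mate d := by rw [hd]; exact hv.ne_inr hvU k hyl
    refine ⟨0, hy' hyx 0, fun u hu => ?_⟩
    obtain rfl := Finset.mem_singleton.1 hu
    have h1 := hmatex 0
    have h2 := hmatey hyx 0
    have h3 := hCΛ 0 (.inr (u, k + 2)) (hMΛ (.inr (u, k + 2), s) (by simp))
    rw [hc'.realizes (.inr (u, k + 2), s) (by simp)] at h3
    have c1 := col_eq_not hd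
    have c2 := col_eq_not he
    rw [D.col_inr u k (k + 2)] at c1
    rw [D.col_inr u (k + 1) (k + 2), c1] at c2
    dsimp only at h3
    rw [c1] at h3
    rw [← Bool.not_inj c2] at h2
    rw [hd] at h1
    rw [he] at h2
    obtain ⟨n1, n2, n3⟩ := hs.colors_ne (D.col d)
    refine injective_fin3 k ?_ ?_ ?_
    · rwa [h1, h2]
    · rwa [h1, h3]
    · rwa [h2, h3]
  | aitch d e v w k l a b s t hs hd he hvw =>
    have hvU := hWU v (by simp)
    have hwU := hWU w (by simp)
    have hne := ne_of_mate hvw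
    dsimp only at hxl hyl hmatex hmatey hy' hCx
    have hyx : e ≠ D.mate d := by rw [hd]; exact hv.ne_inr hvU k hyl
    obtain ⟨p, n1, n2, n3, n4, n5, n6⟩ := hs.exists_color (D.col d)
    refine ⟨p, hy' hyx p, ?_⟩
    have h1 := hmatex p
    have h2 := hmatey hyx p
    have h3 := hCΛ p (.inr (v, k + 2)) (hMΛ (.inr (v, k + 2), s) (by simp))
    rw [hc'.realizes (.inr (v, k + 2), s) (by simp)] at h3
    have h4 := hCΛ p (.inr (w, l + 1)) (hMΛ (.inr (w, l + 1), t) (by simp))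
    rw [hc'.realizes (.inr (w, l + 1), t) (by simp)] at h4
    have h5 : C p (.inr (v, k + 1)) = p := by
      have m1 : (.inr (v, k + 1) : HalfEdge n V) ∉ Λ := fun h => by
        have := hWΛ v (by simp) _ h
        simp [hne] at this
      have m2 : (.inr (v, k + 1) : HalfEdge n V) ≠ d := (hv.ne_inr hvU _ hxl).symm
      have m3 : (.inr (v, k + 1) : HalfEdge n V) ≠ e := (hv.ne_inr hvU _ hyl).symm
      simp [C, m1, m2, m3, hd, he, hne]
    have h6 : C p (.inr (w, l + 2)) = p := by
      rw [← hvw, hmate, h5]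
      exact inr_mem_live hvU _
    have c1 := col_eq_not hd
    have c2 := col_eq_not he
    have c3 := col_eq_not hvw
    rw [D.col_inr v k (k + 2)] at c1
    rw [D.col_inr w l (l + 1)] at c2
    rw [D.col_inr v (k + 1) (k + 2), D.col_inr w (l + 2) (l + 1), c1, Bool.not_not] at c3
    rw [c3] at c2
    dsimp only at h3 h4
    rw [c1] at h3
    rw [c3] at h4
    rw [show D.col e = !D.col d by rw [c2, Bool.not_not]] at h2
    rw [hd] at h1
    rw [he] at h2
    intro u hu
    simp only [Finset.mem_insert, Finset.mem_singleton] at hu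
    rcases hu with rfl | rfl
    · refine injective_fin3 k ?_ ?_ ?_
      · rwa [h1, h5]
      · rwa [h1, h3]
      · rwa [h5, h3]
    · refine injective_fin3 l ?_ ?_ ?_
      · rwa [h2, h4]
      · rwa [h2, h6]
      · rwa [h4, h6]

theorem Completes.exists_isLiveColoring {D : SL3Web n V} {l : List (Strand n V)} {U : Finset V}
    (h : D.Completes l U) (hv : D.Valid (l.map Prod.fst) U) : ∃ c, D.IsLiveColoring l U c := by
  induction h with
  | done => exact ⟨0, by simp [Realizes], by simp [live], by simp⟩
  | step L R x y M W U h hU hcp ih =>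
    obtain ⟨c', hc'⟩ := ih (h.valid hU hv)
    obtain ⟨c, hc, -⟩ := h.exists_isLiveColoring hU hv hc'
    exact ⟨c, hc⟩

/-- For every stage of a completed growth there is a coloring with the states at this stage. -/
theorem exists_isLiveColoring_of_reflTransGen {D : SL3Web n V} {S T : Stage n V}
    (hST : Relation.ReflTransGen D.GrowthStep S T) (hT : D.Completes T.strands T.drawn)
    (hv : D.Valid (S.strands.map Prod.fst) S.drawn) :
    ∃ c, D.IsLiveColoring S.strands S.drawn c ∧ D.Realizes c T.strands ∧
      live (T.strands.map Prod.fst) T.drawn ⊆ live (S.strands.map Prod.fst) S.drawn := by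
  induction hST using Relation.ReflTransGen.head_induction_on with
  | refl =>
    obtain ⟨c, hc⟩ := hT.exists_isLiveColoring hv
    exact ⟨c, hc, hc.realizes, le_rfl⟩
  | @head S S' h _ ih =>
    obtain ⟨L, R, x, y, M, W, hr, hU, hl, rfl⟩ := (D.growthStep_iff _ _).1 h
    rw [hl] at hv ⊢
    obtain ⟨c', hc', hT', hsub⟩ := ih (hr.valid hU hv)
    obtain ⟨c, hc, hcc⟩ := hr.exists_isLiveColoring hU hv hc'
    refine ⟨c, hc, fun z hz => ?_, hsub.trans (hr.live_subset hU hv)⟩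
    rw [hcc, hT' z hz]
    exact hsub (mem_live.2 (.inl (List.mem_map_of_mem hz)))

end SL3Web

namespace SL3Web

variable {n : ℕ} {V : Type*} [DecidableEq V] [Fintype V]

/-! ### The labeling and its coloring -/

/-- Dominance is automatic once the growth can be completed. -/
theorem isKKLabeling_iff {D : SL3Web n V} {J : Fin n → SignType} :
    D.IsKKLabeling J ↔ D.Completes (List.ofFn fun i => ((.inl i : HalfEdge n V), J i)) ∅ :=
  ⟨fun h => (D.completes_iff (start J)).2 h.2,
    fun h => ⟨h.isDominant, (D.completes_iff (start J)).1 h⟩⟩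

theorem live_start (J : Fin n → SignType) :
    live ((start (V := V) J).strands.map Prod.fst) (start (V := V) J).drawn = Finset.univ := by
  ext x
  rcases x with i | ⟨v, k⟩ <;> simp [mem_live, start, List.mem_ofFn]

theorem valid_start (D : SL3Web n V) (J : Fin n → SignType) :
    D.Valid ((start (V := V) J).strands.map Prod.fst) (start (V := V) J).drawn := by
  refine ⟨?_, ?_, ?_⟩
  · rw [start, List.map_ofFn]
    exact List.nodup_ofFn.2 Sum.inl_injective
  · simp [start, List.mem_ofFn]
  · simp [live_start]

theorem IsLiveColoring.isProper {D : SL3Web n V} {J : Fin n → SignType}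
    {c : HalfEdge n V → SignType}
    (h : D.IsLiveColoring (start J).strands (start (V := V) J).drawn c) : D.IsProper c :=
  ⟨fun d => h.mate_eq d (by simp [live_start]), fun v => h.injective v (by simp [start])⟩

theorem IsKKLabeling.eq_of_realizes {D : SL3Web n V} {J : Fin n → SignType}
    (hJ : D.IsKKLabeling J) {c c' : HalfEdge n V → SignType} (hc : D.IsProper c)
    (hc' : D.IsProper c') (h : D.Realizes c (start J).strands)
    (h' : D.Realizes c' (start J).strands) : c = c' := by
  funext x
  rcases x with i | ⟨v, k⟩
  · have hi : (.inl i, J i) ∈ (start (V := V) J).strands := List.mem_ofFn.2 ⟨i, rfl⟩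
    exact (h _ hi).trans (h' _ hi).symm
  · exact (isKKLabeling_iff.1 hJ).eq_of_realizes hc hc' h h' v (by simp) k

/-- The coloring must match the states in every growth, not just in one. Each stage of a completed
growth has a proper coloring with both its states and those of `J`; since `J` determines the
coloring, all of these coincide. -/
theorem IsKKLabeling.exists_isKKColoring {D : SL3Web n V} {J : Fin n → SignType}
    (hJ : D.IsKKLabeling J) : ∃ c, D.IsKKColoring J c := by
  obtain ⟨c, hc⟩ := (isKKLabeling_iff.1 hJ).exists_isLiveColoring (D.valid_start J)
  refine ⟨c, hc.isProper, fun T hT hT' d j hd => ?_⟩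
  obtain ⟨c', hc', hcT, -⟩ :=
    exists_isLiveColoring_of_reflTransGen hT ((D.completes_iff T).2 hT') (D.valid_start J)
  rw [hJ.eq_of_realizes hc.isProper hc'.isProper hc.realizes hc'.realizes]
  exact hcT _ hd

theorem IsKKColoring.realizes {D : SL3Web n V} {J : Fin n → SignType} (hJ : D.IsKKLabeling J)
    {c : HalfEdge n V → SignType} (hc : D.IsKKColoring J c) : D.Realizes c (start J).strands :=
  fun x hx => hc.2 _ .refl hJ.2 x.1 x.2 hx

theorem IsKKColoring.lexLT {D : SL3Web n V} {J : Fin n → SignType} (hJ : D.IsKKLabeling J)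
    {c c' : HalfEdge n V → SignType} (hc : D.IsKKColoring J c) (hc' : D.IsProper c')
    (hne : c' ≠ c) : D.LexLT c c' :=
  (isKKLabeling_iff.1 hJ).lexLT hc.1 hc' (hc.realizes hJ) hne

omit [DecidableEq V] [Fintype V] in
theorem ColorLT.asymm {D : SL3Web n V} {i : Fin n} {a b : SignType} (h : D.ColorLT i a b) :
    ¬ D.ColorLT i b a := by
  unfold ColorLT at *
  split_ifs at * <;> exact lt_asymm h

omit [DecidableEq V] [Fintype V] in
theorem LexLT.asymm {D : SL3Web n V} {c c' : HalfEdge n V → SignType} (h : D.LexLT c c') :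
    ¬ D.LexLT c' c := by
  obtain ⟨i, hi, hlt⟩ := h
  rintro ⟨j, hj, hlt'⟩
  rcases lt_trichotomy i j with hij | rfl | hij
  · have hlt : D.ColorLT i (c (.inl i)) (c' (.inl i)) := hlt
    rw [← show c' (.inl i) = c (.inl i) from hj i hij] at hlt
    exact hlt.asymm hlt
  · exact ColorLT.asymm hlt hlt'
  · have hlt' : D.ColorLT j (c' (.inl j)) (c (.inl j)) := hlt'
    rw [← show c (.inl j) = c' (.inl j) from hi j hij] at hlt'
    exact hlt'.asymm hlt'

/-- If the two colorings differed, each would be lexicographically smaller than the other; and a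
coloring determines its labeling at the boundary. -/
theorem IsKKLabeling.unique {D : SL3Web n V} {J J' : Fin n → SignType} (hJ : D.IsKKLabeling J)
    (hJ' : D.IsKKLabeling J') : J = J' := by
  obtain ⟨c, hc⟩ := hJ.exists_isKKColoring
  obtain ⟨c', hc'⟩ := hJ'.exists_isKKColoring
  have hcc : c = c' := by
    by_contra hne
    exact (hc.lexLT hJ hc'.1 (Ne.symm hne)).asymm (hc'.lexLT hJ' hc.1 hne)
  funext i
  have h1 := hc.realizes hJ (.inl i, J i) (List.mem_ofFn.2 ⟨i, rfl⟩)
  have h2 := hc'.realizes hJ' (.inl i, J' i) (List.mem_ofFn.2 ⟨i, rfl⟩)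
  rw [← hcc, h1] at h2
  exact twist_injective _ h2

/-! ### The leading term -/

omit [DecidableEq V] [Fintype V] in
theorem exponent_apply (c : HalfEdge n V → SignType) (i : Fin n) (a : SignType) :
    exponent c (i, a) = if c (.inl i) = a then 1 else 0 := by
  rw [exponent, Finsupp.finsetSum_apply, Finset.sum_eq_single i]
  · simp [Finsupp.single_apply]
  · intro j _ hj
    simp [hj]
  · simp

omit [DecidableEq V] [Fintype V] in
theorem degree_exponent (c : HalfEdge n V → SignType) : (exponent c).degree = n := by
  simp [exponent]

omit [DecidableEq V] [Fintype V] in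
-- At a boundary vertex the variables are ordered oppositely to the colors. So at the first
-- difference `i` the smallest variable with differing exponents is that of the larger color `c'
-- (.inl i)`; it occurs only for `c'`, which makes that monomial smaller.
theorem LexLT.grevlexLT {D : SL3Web n V} {c c' : HalfEdge n V → SignType} (h : D.LexLT c c') :
    D.GrevlexLT (exponent c') (exponent c) := by
  obtain ⟨i, hi, hlt⟩ := h
  have hlt : D.ColorLT i (c (.inl i)) (c' (.inl i)) := hlt
  refine .inr ⟨by rw [degree_exponent, degree_exponent], (i, c' (.inl i)), ?_, ?_⟩
  · rintro ⟨j, a⟩ hy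
    rw [exponent_apply, exponent_apply]
    rcases hy with hji | ⟨hji, ha⟩
    · have : c (.inl j) = c' (.inl j) := hi j hji
      rw [this]
    · dsimp only at hji ha
      subst hji
      unfold ColorLT at hlt
      split_ifs at hlt ha
      · rw [if_neg ha.ne', if_neg (ha.trans hlt).ne']
      · rw [if_neg ha.ne, if_neg (hlt.trans ha).ne]
  · rw [exponent_apply, exponent_apply, if_pos rfl, if_neg]
    · exact one_pos
    · intro h
      rw [h] at hlt
      exact hlt.asymm hlt

omit [DecidableEq V] [Fintype V] in
theorem LexLT.exponent_ne {D : SL3Web n V} {c c' : HalfEdge n V → SignType} (h : D.LexLT c c') :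
    exponent c' ≠ exponent c := by
  obtain ⟨i, hi, hlt⟩ := h
  have hlt : D.ColorLT i (c (.inl i)) (c' (.inl i)) := hlt
  intro h
  have h1 := DFunLike.congr_fun h (i, c' (.inl i))
  rw [exponent_apply, exponent_apply, if_pos rfl] at h1
  split_ifs at h1 with h2
  rw [h2] at hlt
  exact hlt.asymm hlt

omit [DecidableEq V] in
theorem coloringSign_ne_zero (c : HalfEdge n V → SignType) : coloringSign c ≠ 0 := by
  refine Finset.prod_ne_zero_iff.2 fun v _ => ?_
  unfold vertexSign
  split_ifs <;> decide

omit [DecidableEq V] in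
-- No other proper coloring has the same boundary word, so nothing cancels.
theorem coeff_invariant_of_lexLT {D : SL3Web n V} {c : HalfEdge n V → SignType}
    (hc : D.IsProper c) (hlex : ∀ c', D.IsProper c' → c' ≠ c → D.LexLT c c') :
    D.invariant.coeff (exponent c) = (coloringSign c : ℂ) := by
  classical
  rw [invariant, MvPolynomial.coeff_sum, Finset.sum_eq_single c]
  · rw [MvPolynomial.coeff_monomial, if_pos rfl]
  · intro c' hc' hne
    rw [MvPolynomial.coeff_monomial, if_neg]
    exact (hlex c' (Finset.mem_filter.1 hc').2 hne).exponent_ne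
  · intro h
    exact absurd (Finset.mem_filter.2 ⟨by convert Finset.mem_univ c, hc⟩) h

omit [DecidableEq V] in
theorem isLeadingMonomial_of_lexLT {D : SL3Web n V} {c : HalfEdge n V → SignType}
    (hc : D.IsProper c) (hlex : ∀ c', D.IsProper c' → c' ≠ c → D.LexLT c c') :
    D.IsLeadingMonomial D.invariant (exponent c) := by
  classical
  refine ⟨?_, fun m hm hne => ?_⟩
  · rw [MvPolynomial.mem_support_iff, coeff_invariant_of_lexLT hc hlex]
    exact_mod_cast coloringSign_ne_zero c
  · rw [invariant] at hm
    obtain ⟨c', hc', hm'⟩ := Finset.mem_biUnion.1 (MvPolynomial.support_sum hm)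
    obtain rfl := Finset.mem_singleton.1 (MvPolynomial.support_monomial_subset hm')
    refine (hlex c' (Finset.mem_filter.1 hc').2 ?_).grevlexLT
    rintro rfl
    exact hne rfl

end SL3Web

open SL3Web in
/-- A non-elliptic web, all of whose boundary vertices have degree one, has a unique KK-labeling;
the edge coloring determined by it is unique, and is lexicographically smaller than every other
proper edge coloring; its monomial is the leading monomial of the invariant of the web, and its sign
is the leading coefficient. -/
theorem theorem3p2 {n : ℕ} {V : Type*} [Fintype V] [DecidableEq V] (D : SL3Web n V)
    (hplanar : D.IsPlanar) (hD : D.IsNonElliptic) :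
    (∃! J : Fin n → SignType, D.IsKKLabeling J) ∧
    ∀ J : Fin n → SignType, D.IsKKLabeling J →
      (∃! c : HalfEdge n V → SignType, D.IsKKColoring J c) ∧
      ∀ c : HalfEdge n V → SignType, D.IsKKColoring J c →
        (∀ c' : HalfEdge n V → SignType, D.IsProper c' → c' ≠ c → D.LexLT c c') ∧
        D.IsLeadingMonomial D.invariant (SL3Web.exponent c) ∧
        D.invariant.coeff (SL3Web.exponent c) = (SL3Web.coloringSign c : ℂ) := by
  refine ⟨?_, fun J hJ => ⟨?_, fun c hc => ?_⟩⟩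
  · obtain ⟨J, hJ⟩ := hplanar.exists_completes_start hD
    exact ⟨J, isKKLabeling_iff.2 hJ, fun J' hJ' => hJ'.unique (isKKLabeling_iff.2 hJ)⟩
  · obtain ⟨c, hc⟩ := hJ.exists_isKKColoring
    exact ⟨c, hc, fun c' hc' =>
      hJ.eq_of_realizes hc'.1 hc.1 (hc'.realizes hJ) (hc.realizes hJ)⟩
  · have hlex : ∀ c', D.IsProper c' → c' ≠ c → D.LexLT c c' := fun c' hc' hne =>
      hc.lexLT hJ hc' hne
    exact ⟨hlex, isLeadingMonomial_of_lexLT hc.1 hlex, coeff_invariant_of_lexLT hc.1 hlex⟩
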